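/- **Setting.** A *pseudo-composition* of $n$ is a sequence $\alpha=(\alpha_1,\ldots,\alpha_\ell)$, $\ell\ge1$, of integers with $\alpha_1\ge0$, $\alpha_2,\ldots,\alpha_\ell>0$ and size $|\alpha|=\alpha_1+\cdots+\alpha_\ell=n$; put $\ell(\alpha)=\ell$ and $D(\alpha)=\{\alpha_1,\alpha_1+\alpha_2,\ldots,\alpha_1+\cdots+\alpha_{\ell-1}\}$, and write $\alpha\preccurlyeq\beta$ if $|\alpha|=|\beta|$ and $D(\alpha)\subseteq D(\beta)$. It is a *pseudo-partition* if $\alpha_2\ge\cdots\ge\alpha_\ell$; let $\lambda^B(\alpha)$ be the pseudo-partition obtained from $\alpha$ by rearranging $\alpha_2,\ldots,\alpha_\ell$. Let $\mathbf x_i$ ($i\in\mathbb Z$) be noncommuting and $x_0,x_1,x_2,\ldots$ commuting variables. Put $$\mathbf h_k=\sum_{i_1\le\cdots\le i_k}\mathbf x_{i_1}\cdots\mathbf x_{i_k},\qquad \mathbf h^B_k=\sum_{0\le i_1\le\cdots\le i_k}\mathbf x_{i_1}\cdots\mathbf x_{i_k},$$ $\mathbf h_\alpha=\mathbf h_{\alpha_1}\cdots\mathbf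 h_{\alpha_\ell}$ for a composition $\alpha$ (a possibly empty sequence of positive integers), $\mathbf h^B_\alpha=\mathbf h^B_{\alpha_1}\mathbf h_{\alpha_2}\cdots\mathbf h_{\alpha_\ell}$ and $\mathbf s^B_\alpha=\sum_{\beta\preccurlyeq\alpha}(-1)^{\ell(\alpha)-\ell(\beta)}\mathbf h^B_\beta$ for a pseudo-composition $\alpha$. Let $\mathrm{NSym}$ be the $\mathbb Z$-span of all $\mathbf h_\alpha$ and $\mathrm{NSym}^B$ the $\mathbb Z$-span of all $\mathbf h^B_\alpha$. Let $\chi$ be the substitution $\mathbf x_i\mapsto x_i$ for $i>0$, $\mathbf x_i\mapsto0$ for $i\le0$, and $\chi^B$ the substitution $\mathbf x_i\mapsto x_{|i|}$ for all $i$. Put $\mathrm{Sym}=\chi(\mathrm{NSym})$, $\mathrm{Sym}^B=\chi^B(\mathrm{NSym}^B)$, $h^B_\alpha=\chi^B(\mathbf h^B_\alpha)$, $s^B_\alpha=\chi^B(\mathbf s^B_\alpha)$. Put $M^B_\alpha=\sum_{0<i_2<\cdots<i_\ell}x_0^{\alpha_1}x_{i_2}^{\alpha_2}\cdots x_{i_\ell}^{\alpha_\ell}$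 and, for a pseudo-partition $\lambda$, $m^B_\lambda=\sum_{\lambda^B(\alpha)=\lambda}M^B_\alpha$. For a field $\mathbb K$ of characteristic zero and a $\mathbb Z$-module $U$ of power series with integer coefficients let $U_{\mathbb K}$ be the image of $\mathbb K\otimes_{\mathbb Z}U$ in the power series over $\mathbb K$. Let $\mathfrak S^B_n$ be the group of signed permutations $w$ of $\{\pm1,\ldots,\pm n\}$, with $w(0)=0$ and $D(w)=\{i\in\{0,\ldots,n-1\}:w(i)>w(i+1)\}$. **Statement.** 1. If $\lambda$ is a pseudo-partition, then $h^B_\lambda:=h^B_\alpha$ does not depend on the choice of a pseudo-composition $\alpha$ with $\lambda^B(\alpha)=\lambda$, and $\{h^B_\lambda\}$, with $\lambda$ running through all pseudo-partitions, is a free $\mathbb Z$-basis of $\mathrm{Sym}^B$. 2. $\mathrm{Sym}^B\subsetneq\mathbb Z[x_0]\cdot\mathrm{Sym}$, and multiplication $p\otimes f\mapsto p(x_0)f$ is an isomorphism $\mathbb Z[x_0]\otimes_{\mathbb Z}\mathrm{Sym}\cong\mathbb Z[x_0]\cdot\mathrm{Sym}$. 3. Let $\mathbb K$ be a field of characteristic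 zero. Then $\mathbb K\otimes_{\mathbb Z}\mathrm{Sym}^B\to\mathrm{Sym}^B_{\mathbb K}$ and $\mathbb K\otimes_{\mathbb Z}\mathrm{Sym}\to\mathrm{Sym}_{\mathbb K}$ are isomorphisms, $\mathrm{Sym}^B_{\mathbb K}=\mathbb K[x_0]\cdot\mathrm{Sym}_{\mathbb K}$, and multiplication is an isomorphism $\mathbb K[x_0]\otimes_{\mathbb K}\mathrm{Sym}_{\mathbb K}\cong\mathbb K[x_0]\cdot\mathrm{Sym}_{\mathbb K}$. 4. Let $\mathbb K$ be a field of characteristic zero. There is a unique $\mathbb K$-bilinear form on $\mathrm{Sym}^B_{\mathbb K}$ such that $\langle s^B_\alpha,s^B_\beta\rangle=\#\{w\in\mathfrak S^B_n:D(w^{-1})=D(\alpha),\ D(w)=D(\beta)\}$ if $|\alpha|=|\beta|=n$ and $\langle s^B_\alpha,s^B_\beta\rangle=0$ if $|\alpha|\ne|\beta|$. It is symmetric and nondegenerate, and with respect to it $\{h^B_\lambda\}$ and $\{m^B_\lambda\}$ are dual $\mathbb K$-bases of $\mathrm{Sym}^B_{\mathbb K}$: $\langle h^B_\lambda,m^B_\mu\rangle=\delta_{\lambda,\mu}$.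 -/

import Mathlib

open scoped TensorProduct

noncomputable section

namespace TypeB

/-! ### Pseudo-compositions and pseudo-partitions -/

/-- A composition: a (possibly empty) finite sequence of positive integers. -/
abbrev Comp : Type := {α : List ℕ // ∀ a ∈ α, 0 < a}

/-- A pseudo-composition `(α₁, α₂, …, α_ℓ)` with `ℓ ≥ 1`, `α₁ = head ≥ 0` and
`(α₂, …, α_ℓ) = tail` a sequence of positive integers. -/
@[ext]
structure PseudoComp : Type where
  head : ℕ
  tail : List ℕ
  tail_pos : ∀ a ∈ tail, 0 < a

namespace PseudoComp

/-- The size `|α| = α₁ + ⋯ + α_ℓ`. -/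
def size (α : PseudoComp) : ℕ := α.head + α.tail.sum

/-- The length `ℓ(α)`. -/
def length (α : PseudoComp) : ℕ := α.tail.length + 1

/-- The descent set `D(α) = {α₁, α₁ + α₂, …, α₁ + ⋯ + α_{ℓ-1}}`. -/
def descents (α : PseudoComp) : Finset ℕ :=
  (Finset.range α.tail.length).image fun i => α.head + (α.tail.take i).sum

/-- `α ≼ β`: the sizes agree and `D(α) ⊆ D(β)`. -/
def Coarser (α β : PseudoComp) : Prop := α.size = β.size ∧ α.descents ⊆ β.descents

end PseudoComp

/-- A pseudo-partition: a pseudo-composition with `λ₂ ≥ ⋯ ≥ λ_ℓ (≥ 1)`. -/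
abbrev PseudoPart : Type := {l : PseudoComp // l.tail.Pairwise (· ≥ ·)}

/-- The pseudo-partition `λᴮ(α)`: keep `α₁`, rearrange `α₂, …, α_ℓ` weakly decreasingly. -/
def PseudoComp.toPart (α : PseudoComp) : PseudoPart :=
  ⟨⟨α.head, α.tail.insertionSort (· ≥ ·),
    fun a ha => α.tail_pos a ((List.mem_insertionSort (· ≥ ·)).1 ha)⟩,
    List.pairwise_insertionSort (· ≥ ·) α.tail⟩

/-! ### Power series in noncommuting variables `𝐱ᵢ`, `i ∈ ℤ` -/

/-- Formal power series over `ℤ` in noncommuting variables `𝐱ᵢ` (`i ∈ ℤ`): `f w` is the coefficient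
of the word `𝐱_{w₁} 𝐱_{w₂} ⋯`.  The product of two series is `ncMul`, not the pointwise one. -/
abbrev NCSeries : Type := List ℤ → ℤ

/-- The product (concatenation of words, extended bilinearly) of noncommutative series. -/
def ncMul (f g : NCSeries) : NCSeries := fun w =>
  ∑ i ∈ Finset.range (w.length + 1), f (w.take i) * g (w.drop i)

/-- The unit series (the empty word). -/
def ncOne : NCSeries := fun w => if w = [] then 1 else 0

/-- `𝐡_k = ∑_{i₁ ≤ ⋯ ≤ i_k} 𝐱_{i₁} ⋯ 𝐱_{i_k}`, the indices running through `ℤ`. -/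
def ncH (k : ℕ) : NCSeries := fun w =>
  if w.length = k ∧ w.Pairwise (· ≤ ·) then 1 else 0

/-- `𝐡ᴮ_k = ∑_{0 ≤ i₁ ≤ ⋯ ≤ i_k} 𝐱_{i₁} ⋯ 𝐱_{i_k}`. -/
def ncHB (k : ℕ) : NCSeries := fun w =>
  if w.length = k ∧ w.Pairwise (· ≤ ·) ∧ ∀ a ∈ w, 0 ≤ a then 1 else 0

/-- `𝐡_α = 𝐡_{α₁} ⋯ 𝐡_{α_ℓ}` for a composition `α`. -/
def ncHComp (α : Comp) : NCSeries := (α.1.map ncH).foldl ncMul ncOne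

/-- `𝐡ᴮ_α = 𝐡ᴮ_{α₁} · 𝐡_{α₂} ⋯ 𝐡_{α_ℓ}` for a pseudo-composition `α`. -/
def ncHBComp (α : PseudoComp) : NCSeries := (α.tail.map ncH).foldl ncMul (ncHB α.head)

/-- `𝐬ᴮ_α = ∑_{β ≼ α} (-1)^{ℓ(α) - ℓ(β)} 𝐡ᴮ_β`, i.e. the solution of `𝐡ᴮ_α = ∑_{β ≼ α} 𝐬ᴮ_β`
(the sum is finite). -/
def ncSBComp (α : PseudoComp) : NCSeries :=
  ∑ᶠ β ∈ {β : PseudoComp | β.Coarser α}, (-1 : ℤ) ^ (α.length - β.length) • ncHBComp β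

/-- `NSym`: noncommutative symmetric functions, the `ℤ`-span of all `𝐡_α`. -/
def NSym : Submodule ℤ NCSeries := Submodule.span ℤ (Set.range ncHComp)

/-- `NSymᴮ`: noncommutative symmetric functions of type B, the `ℤ`-span of all `𝐡ᴮ_α`. -/
def NSymB : Submodule ℤ NCSeries := Submodule.span ℤ (Set.range ncHBComp)

theorem ncSBComp_mem (α : PseudoComp) : ncSBComp α ∈ NSymB :=
  finsum_mem_induction (· ∈ NSymB) (Submodule.zero_mem _)
    (fun _ _ hx hy => Submodule.add_mem _ hx hy)
    (fun β _ => Submodule.smul_mem _ _ (Submodule.subset_span ⟨β, rfl⟩))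

/-! ### Passage to commuting variables `x₀, x₁, x₂, …` -/

/-- The commutative monomial `x_{|w₁|} x_{|w₂|} ⋯` of a word `w`, as an exponent vector. -/
def content (w : List ℤ) : ℕ →₀ ℕ := Multiset.toFinsupp (w.map Int.natAbs : Multiset ℕ)

/-- Words with letters in `L` and commutative monomial `m`. -/
def words (L : Set ℤ) (m : ℕ →₀ ℕ) : Set (List ℤ) := {w | (∀ a ∈ w, a ∈ L) ∧ content w = m}

theorem words_finite (L : Set ℤ) (m : ℕ →₀ ℕ) : (words L m).Finite := by
  set N : ℕ := (Finsupp.toMultiset m).sum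
  set T : Set ℤ := {a : ℤ | a.natAbs ≤ N}
  have hT : T.Finite := (Set.finite_Icc (-(N : ℤ)) N).subset fun a (ha : a.natAbs ≤ N) => by
    constructor <;> omega
  have := hT.to_subtype
  refine ((List.finite_length_eq T (Multiset.card (Finsupp.toMultiset m))).image
    (List.map Subtype.val)).subset ?_
  rintro w ⟨-, hw⟩
  have hw' : (w.map Int.natAbs : Multiset ℕ) = Finsupp.toMultiset m := by
    rw [← hw, content, Multiset.toFinsupp_toMultiset]
  have hmem : ∀ a ∈ w, a ∈ T := fun a ha => by
    have h1 : a.natAbs ∈ Finsupp.toMultiset m := by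
      rw [← hw']
      exact Multiset.mem_coe.2 (List.mem_map_of_mem ha)
    exact Multiset.le_sum_of_mem h1
  refine ⟨w.attach.map fun a => ⟨a.1, hmem a.1 a.2⟩, ?_, ?_⟩
  · rw [← hw']
    simp
  · simp

/-- The substitution `𝐱ᵢ ↦ x_{|i|}` for `i ∈ L` and `𝐱ᵢ ↦ 0` for `i ∉ L`, on series in noncommuting
variables (each commutative monomial is the image of finitely many words). -/
def commutize (L : Set ℤ) : NCSeries →ₗ[ℤ] MvPowerSeries ℕ ℤ where
  toFun f := fun m => ∑ᶠ w ∈ words L m, f w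
  map_add' f g := by
    funext m
    exact finsum_mem_add_distrib (words_finite L m)
  map_smul' c f := by
    funext m
    exact (smul_finsum_mem (r := c) (f := f) (words_finite L m)).symm

/-- `χ`: replace `𝐗` by the commuting variables `X_{>0} = {x₁, x₂, …}`. -/
def chi : NCSeries →ₗ[ℤ] MvPowerSeries ℕ ℤ := commutize (Set.Ioi 0)

/-- `χᴮ`: the substitution `𝐱ᵢ ↦ x_{|i|}` for all `i ∈ ℤ`. -/
def chiB : NCSeries →ₗ[ℤ] MvPowerSeries ℕ ℤ := commutize Set.univ

/-- `Sym = χ(NSym)`: symmetric functions over `ℤ` in `x₁, x₂, …` (Mathlib uses the name `Sym` for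
symmetric powers). -/
def SymF : Submodule ℤ (MvPowerSeries ℕ ℤ) := NSym.map chi

/-- `Symᴮ = χᴮ(NSymᴮ)`: symmetric functions of type B over `ℤ`. -/
def SymB : Submodule ℤ (MvPowerSeries ℕ ℤ) := NSymB.map chiB

/-- `hᴮ_α = χᴮ(𝐡ᴮ_α)`. -/
def hB (α : PseudoComp) : MvPowerSeries ℕ ℤ := chiB (ncHBComp α)

/-- `sᴮ_α = χᴮ(𝐬ᴮ_α)`, as an element of `Symᴮ`. -/
def sB (α : PseudoComp) : SymB := ⟨chiB (ncSBComp α), Submodule.mem_map_of_mem (ncSBComp_mem α)⟩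

/-- The monomial quasisymmetric function of type B,
`Mᴮ_α = ∑_{0 < i₂ < ⋯ < i_ℓ} x₀^{α₁} x_{i₂}^{α₂} ⋯ x_{i_ℓ}^{α_ℓ}`. -/
def MB (α : PseudoComp) : MvPowerSeries ℕ ℤ := fun m =>
  (Nat.card {i : Fin α.tail.length → ℕ // StrictMono i ∧ (∀ j, 0 < i j) ∧
    Finsupp.single 0 α.head + ∑ j, Finsupp.single (i j) (α.tail.get j) = m} : ℤ)

/-- `mᴮ_λ = ∑_{λᴮ(α) = λ} Mᴮ_α` (a finite sum). -/
def mB (l : PseudoPart) : MvPowerSeries ℕ ℤ :=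
  ∑ᶠ α ∈ {α : PseudoComp | α.toPart = l}, MB α

/-! ### `R[x₀] · U`, and extension of scalars -/

section scalars

variable (R : Type*) [CommRing R]

/-- The product `R[x₀] · U` inside the ring of power series in `x₀, x₁, …`. -/
def polyMul (U : Submodule R (MvPowerSeries ℕ R)) : Submodule R (MvPowerSeries ℕ R) :=
  Subalgebra.toSubmodule (Algebra.adjoin R {(MvPowerSeries.X 0 : MvPowerSeries ℕ R)}) * U

/-- The multiplication map `R[x₀] ⊗ U → R[[x₀, x₁, …]]`, `p ⊗ f ↦ p(x₀) · f`. -/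
def tensorMul (U : Submodule R (MvPowerSeries ℕ R)) :
    Polynomial R ⊗[R] U →ₗ[R] MvPowerSeries ℕ R :=
  LinearMap.mul' R (MvPowerSeries ℕ R) ∘ₗ
    TensorProduct.map
      (Polynomial.aeval (MvPowerSeries.X 0 : MvPowerSeries ℕ R)).toLinearMap U.subtype

/-- The map `R ⊗_ℤ U → R[[x₀, x₁, …]]`, `c ⊗ f ↦ c f`, for a `ℤ`-module `U` of power series with
integer coefficients. -/
def scalarExt (U : Submodule ℤ (MvPowerSeries ℕ ℤ)) : R ⊗[ℤ] U →ₗ[R] MvPowerSeries ℕ R :=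
  TensorProduct.AlgebraTensorModule.lift
    (LinearMap.toSpanSingleton R (U →ₗ[ℤ] MvPowerSeries ℕ R)
      ((MvPowerSeries.map (Int.castRingHom R)).toAddMonoidHom.toIntLinearMap ∘ₗ U.subtype))

/-- `U_R`: the image of `R ⊗_ℤ U` in `R[[x₀, x₁, …]]`. -/
def extended (U : Submodule ℤ (MvPowerSeries ℕ ℤ)) : Submodule R (MvPowerSeries ℕ R) :=
  LinearMap.range (scalarExt R U)

/-- The image of `1 ⊗ f` in `U_R`. -/
def toExtended {U : Submodule ℤ (MvPowerSeries ℕ ℤ)} (f : U) : extended R U :=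
  ⟨scalarExt R U (1 ⊗ₜ f), LinearMap.mem_range_self _ _⟩

end scalars

/-! ### Signed permutations and the bilinear form -/

/-- The hyperoctahedral group `𝔖ᴮ_n` of signed permutations of `{±1, …, ±n}`; they are extended to
`ℤ` by fixing `0` and all `i` with `|i| > n`. -/
def SignedPerm (n : ℕ) : Subgroup (Equiv.Perm ℤ) where
  carrier := {w | (∀ i, w (-i) = -w i) ∧ ∀ i : ℤ, (n : ℤ) < |i| → w i = i}
  one_mem' := by simp
  mul_mem' := by
    rintro u v ⟨hu, hu'⟩ ⟨hv, hv'⟩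
    refine ⟨fun i => by simp [hu, hv], fun i hi => ?_⟩
    simp [hv' i hi, hu' i hi]
  inv_mem' := by
    rintro u ⟨hu, hu'⟩
    refine ⟨fun i => ?_, fun i hi => ?_⟩
    · rw [Equiv.Perm.inv_eq_iff_eq, hu]; simp
    · rw [Equiv.Perm.inv_eq_iff_eq, hu' i hi]

/-- The descent set `D(w) = {i ∈ {0, …, n-1} : w(i) > w(i+1)}` (where `w(0) = 0`). -/
def SignedPerm.descents {n : ℕ} (w : SignedPerm n) : Finset ℕ :=
  (Finset.range n).filter fun i => w.1 (i : ℤ) > w.1 ((i : ℤ) + 1)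

/-- `c_{αβ} = #{w ∈ 𝔖ᴮ_n : D(w⁻¹) = D(α), D(w) = D(β)}` if `α`, `β` have the same size `n`, and
`c_{αβ} = 0` otherwise. -/
def formCoeff (α β : PseudoComp) : ℕ :=
  if α.size = β.size then
    Nat.card {w : SignedPerm β.size // SignedPerm.descents w⁻¹ = α.descents ∧
      SignedPerm.descents w = β.descents}
  else 0

/-- `B` is the bilinear form on `Symᴮ_K` given by `⟨sᴮ_α, sᴮ_β⟩ = c_{αβ}`. -/
def IsSymBForm (K : Type*) [Field K] (B : LinearMap.BilinForm K (extended K SymB)) : Prop :=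
  ∀ α β : PseudoComp, B (toExtended K (sB α)) (toExtended K (sB β)) = (formCoeff α β : K)

end TypeB

end

open TypeB

/-!
Let `H(t) = ∑ h_k(x₁, x₂, …) tᵏ`.  Under `χᴮ` the generating series of the `𝐡ᴮ_k` becomes
`H(t) / (1 - x₀ t)`, and that of the `𝐡_k` becomes `G(t) = H(t)² / (1 - x₀ t)`, since every
`x_i` with `i > 0` comes from the two letters `±i`.  Over a `ℚ`-algebra `G` has a square root
`√G = H(t) / (1 - x₀ t)^{1/2}`, whose coefficients are polynomials in those of `G`, and the first
series equals `√G · (1 - x₀ t)^{-1/2}`.  The coefficients of `(1 - x₀ t)^{-1/2}` are nonzero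
rational multiples of the powers of `x₀`, so every `x₀ⁿ` lies in the span of the `hᴮ_α`; this gives
`Symᴮ_K = K[x₀] · Sym_K`, which is also the span of the `mᴮ_λ`.  In each degree the `hᴮ_λ` are as
many as the `mᴮ_λ`, so they form a basis too, and independence over `ℚ` implies independence over
`ℤ`.  Integrally `x₀²` is not in `Symᴮ`, as `3 x₀²` has the coefficient `8` at `hᴮ_{(2)}`.

The form is defined by the duality of the `hᴮ_λ` and the `mᴮ_λ`, that is, `⟨hᴮ_α, f⟩` is the
coefficient of `x₀^{α₁} x₁^{α₂} x₂^{α₃} ⋯` in `f`.  For `f = hᴮ_β` this coefficient counts words in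
the letters `0, ±1, ±2, …` whose descent set is contained in `D(β)`.  Standardization matches these
words with the signed permutations `w` such that `D(w⁻¹) ⊆ D(α)` and `D(w) ⊆ D(β)`, and an
alternating sum over the coarsenings of `α` and `β` turns the inclusions into equalities.
-/

noncomputable section

namespace TypeB

open Finset hiding antidiagonal mem_antidiagonal
open Finset.HasAntidiagonal MvPowerSeries

/-! ### The substitution into commuting variables -/

theorem coeff_commutize (L : Set ℤ) (f : NCSeries) (m : ℕ →₀ ℕ) :
    coeff m (commutize L f) = ∑ w ∈ (words_finite L m).toFinset, f w :=
  finsum_mem_eq_finite_toFinset_sum f (words_finite L m)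

theorem mem_words {L : Set ℤ} {m : ℕ →₀ ℕ} {w : List ℤ} :
    w ∈ words L m ↔ (∀ a ∈ w, a ∈ L) ∧ content w = m :=
  Iff.rfl

theorem content_append (u v : List ℤ) : content (u ++ v) = content u + content v := by
  simp [content, ← Multiset.coe_add]

theorem toMultiset_content (w : List ℤ) :
    Finsupp.toMultiset (content w) = (w.map Int.natAbs : Multiset ℕ) := by
  rw [content, Multiset.toFinsupp_toMultiset]

theorem degree_content (w : List ℤ) : (content w).degree = w.length := by
  have h := Finsupp.card_toMultiset (content w)
  rw [toMultiset_content, Multiset.coe_card, List.length_map] at h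
  exact h.symm

theorem commutize_ncMul (L : Set ℤ) (f g : NCSeries) :
    commutize L (ncMul f g) = commutize L f * commutize L g := by
  ext m
  rw [coeff_mul, coeff_commutize]
  simp only [coeff_commutize, ncMul, sum_mul_sum, ← sum_product']
  rw [sum_sigma', sum_sigma']
  refine sum_bij' (fun x _ => ⟨(content (x.1.take x.2), content (x.1.drop x.2)),
    (x.1.take x.2, x.1.drop x.2)⟩) (fun y _ => ⟨y.2.1 ++ y.2.2, y.2.1.length⟩) ?_ ?_ ?_ ?_ ?_
  · rintro ⟨w, i⟩ h
    simp only [mem_sigma, Set.Finite.mem_toFinset, mem_words, mem_antidiagonal, mem_product,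
      ← content_append, List.take_append_drop] at h ⊢
    obtain ⟨⟨hwL, hwm⟩, -⟩ := h
    exact ⟨hwm, ⟨fun a ha => hwL a (List.mem_of_mem_take ha), trivial⟩,
      fun a ha => hwL a (List.mem_of_mem_drop ha), trivial⟩
  · rintro ⟨⟨a, b⟩, u, v⟩ h
    simp only [mem_sigma, Set.Finite.mem_toFinset, mem_words, mem_range, mem_antidiagonal,
      mem_product] at h ⊢
    obtain ⟨hab, ⟨huL, hua⟩, hvL, hvb⟩ := h
    refine ⟨⟨fun c hc => ?_, by rw [content_append, hua, hvb, hab]⟩, by simp⟩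
    exact (List.mem_append.1 hc).elim (huL c) (hvL c)
  · rintro ⟨w, i⟩ h
    have hi : i ≤ w.length := Nat.lt_succ_iff.1 (mem_range.1 (mem_sigma.1 h).2)
    simp [hi]
  · rintro ⟨⟨a, b⟩, u, v⟩ h
    simp only [mem_sigma, Set.Finite.mem_toFinset, mem_words, mem_product] at h
    simp [h.2.1.2, h.2.2.2]
  · exact fun _ _ => rfl

theorem commutize_ncOne (L : Set ℤ) : commutize L ncOne = 1 := by
  ext m
  rw [coeff_commutize, coeff_one]
  simp only [ncOne, sum_ite_eq', Set.Finite.mem_toFinset, mem_words]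
  refine if_congr ?_ rfl rfl
  simp [mem_words, content, eq_comm]

theorem commutize_foldl_ncMul (L : Set ℤ) (s : List NCSeries) (f : NCSeries) :
    commutize L (s.foldl ncMul f) = commutize L f * (s.map (commutize L)).prod := by
  induction s generalizing f with
  | nil => simp
  | cons g s ih => simp [ih, commutize_ncMul, mul_assoc]

/-! ### Weakly increasing words -/

/-- The sum of the weakly increasing words of length `k` with letters in `L`.  Both `𝐡_k` and `𝐡ᴮ_k`
are of this form. -/
def ncSorted (L : Set ℤ) (k : ℕ) : NCSeries :=
  Set.indicator {w | w.length = k ∧ w.Pairwise (· ≤ ·) ∧ ∀ a ∈ w, a ∈ L} 1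

theorem ncH_eq_ncSorted (k : ℕ) : ncH k = ncSorted Set.univ k := by
  funext w
  simp [ncH, ncSorted, Set.indicator_apply]

theorem ncHB_eq_ncSorted (k : ℕ) : ncHB k = ncSorted (Set.Ici 0) k := by
  funext w
  simp [ncHB, ncSorted, Set.indicator_apply]

theorem takeWhile_mem_append {A : Type*} {L : Set A} [DecidablePred (· ∈ L)] {u v : List A}
    (hu : ∀ a ∈ u, a ∈ L) (hv : ∀ a ∈ v, a ∉ L) : (u ++ v).takeWhile (· ∈ L) = u := by
  rw [List.takeWhile_append_of_pos (by simpa using hu)]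
  cases v with
  | nil => simp
  | cons b v => simp [hv b]

theorem exists_append_of_pairwise_le {L L' : Set ℤ} (hL : ∀ a ∈ L, ∀ b ∈ L', a < b) {w : List ℤ}
    (hw : w.Pairwise (· ≤ ·)) (hwL : ∀ a ∈ w, a ∈ L ∪ L') :
    ∃ u v, w = u ++ v ∧ (∀ a ∈ u, a ∈ L) ∧ ∀ b ∈ v, b ∈ L' := by
  induction w with
  | nil => exact ⟨[], [], by simp⟩
  | cons a w ih =>
    obtain ⟨haw, hw⟩ := List.pairwise_cons.1 hw
    obtain ⟨ha, hwL⟩ := List.forall_mem_cons.1 hwL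
    by_cases haL : a ∈ L
    · obtain ⟨u, v, rfl, hu, hv⟩ := ih hw hwL
      exact ⟨a :: u, v, rfl, List.forall_mem_cons.2 ⟨haL, hu⟩, hv⟩
    · have haL' : a ∈ L' := ha.resolve_left haL
      exact ⟨[], a :: w, rfl, by simp, List.forall_mem_cons.2 ⟨haL', fun b hb =>
        (hwL b hb).resolve_left fun hbL => ((hL b hbL a haL').trans_le (haw b hb)).false⟩⟩

/-- A weakly increasing word with letters in `L ∪ L'` splits in exactly one way. -/
theorem ncSorted_union {L L' : Set ℤ} (hL : ∀ a ∈ L, ∀ b ∈ L', a < b) (k : ℕ) :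
    ncSorted (L ∪ L') k =
      ∑ p ∈ antidiagonal k, ncMul (ncSorted L p.1) (ncSorted L' p.2) := by
  classical
  have hdisj (b : ℤ) (hb : b ∈ L') : b ∉ L := fun hb' => (hL b hb' b hb).false
  funext w
  simp only [Finset.sum_apply, ncMul, ← sum_product', ncSorted, Set.indicator_apply,
    Set.mem_ofPred_eq, Pi.one_apply, mul_ite, mul_one, mul_zero, ← ite_and]
  rw [sum_ite_zero]
  · refine if_congr ⟨?_, ?_⟩ rfl rfl
    · rintro ⟨rfl, hw, hwL⟩
      obtain ⟨u, v, rfl, hu, hv⟩ := exists_append_of_pairwise_le hL hw hwL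
      obtain ⟨hus, hvs, -⟩ := List.pairwise_append.1 hw
      exact ⟨((u.length, v.length), u.length), by simp, by simp_all⟩
    · rintro ⟨⟨⟨a, b⟩, i⟩, hp, ⟨hvl, hvs, hvL⟩, hul, hus, huL⟩
      rw [mem_product, mem_antidiagonal] at hp
      rw [← List.take_append_drop i w, List.length_append, List.pairwise_append]
      refine ⟨by rw [hul, hvl, hp.1],
        ⟨hus, hvs, fun x hx y hy => (hL x (huL x hx) y (hvL y hy)).le⟩, fun x hx => ?_⟩
      exact (List.mem_append.1 hx).imp (huL x) (hvL x)
  · have split_eq {p : (ℕ × ℕ) × ℕ} (hp : p ∈ antidiagonal k ×ˢ range (w.length + 1))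
        (huL : ∀ a ∈ w.take p.2, a ∈ L) (hvL : ∀ a ∈ w.drop p.2, a ∈ L') :
        p.2 = (w.takeWhile (· ∈ L)).length := by
      have h := takeWhile_mem_append huL fun a ha => hdisj a (hvL a ha)
      rw [List.take_append_drop] at h
      simpa [h] using Nat.lt_succ_iff.1 (mem_range.1 (mem_product.1 hp).2)
    rintro ⟨⟨a, b⟩, i⟩ hp ⟨⟨c, d⟩, j⟩ hq
      ⟨⟨hb, -, hvL⟩, ha, -, huL⟩ ⟨⟨hd, -, hvL'⟩, hc, -, huL'⟩
    obtain rfl : i = j := (split_eq hp huL hvL).trans (split_eq hq huL' hvL').symm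
    exact Prod.ext (Prod.ext (ha.symm.trans hc) (hb.symm.trans hd)) rfl

/-! ### Complete homogeneous series in commuting variables -/

/-- The complete homogeneous series of degree `k` in the variables `x_i` with `i ∈ S`. -/
def complete {σ : Type*} (R : Type*) [CommRing R] (S : Set σ) (k : ℕ) : MvPowerSeries σ R :=
  Set.indicator {m : σ →₀ ℕ | m.degree = k ∧ (m.support : Set σ) ⊆ S} 1

theorem coeff_complete {σ R : Type*} [CommRing R] (S : Set σ) (k : ℕ) (m : σ →₀ ℕ)
    [Decidable (m.degree = k ∧ (m.support : Set σ) ⊆ S)] :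
    coeff m (complete R S k) = if m.degree = k ∧ (m.support : Set σ) ⊆ S then 1 else 0 := by
  rw [coeff_apply, complete, Set.indicator_apply]
  exact if_congr Iff.rfl rfl rfl

theorem map_complete {σ R : Type*} [CommRing R] (S : Set σ) (k : ℕ) :
    MvPowerSeries.map (Int.castRingHom R) (complete ℤ S k) = complete R S k := by
  classical
  ext m
  simp [coeff_map, coeff_complete]

theorem complete_singleton {σ : Type*} (R : Type*) [CommRing R] (i : σ) (k : ℕ) :
    complete R {i} k = X i ^ k := by
  classical
  ext m
  rw [coeff_complete, coeff_X_pow]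
  refine if_congr ⟨fun h => ?_, ?_⟩ rfl rfl
  · obtain ⟨b, rfl⟩ := Finsupp.support_subset_singleton'.1 (mod_cast h.2)
    obtain rfl : b = k := by simpa using h.1
    rfl
  · rintro rfl
    exact ⟨by simp, mod_cast Finsupp.support_single_subset⟩

theorem mem_words_and_sorted_iff {L L' : Set ℤ} (hL : Set.InjOn Int.natAbs (L ∩ L'))
    (m : ℕ →₀ ℕ) (w : List ℤ) :
    (w ∈ words L m ∧ w.Pairwise (· ≤ ·) ∧ ∀ a ∈ w, a ∈ L') ↔
      (m.support : Set ℕ) ⊆ Int.natAbs '' (L ∩ L') ∧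
        w = ((Finsupp.toMultiset m).map (Function.invFunOn Int.natAbs (L ∩ L'))).sort (· ≤ ·) := by
  set g : ℕ → ℤ := Function.invFunOn Int.natAbs (L ∩ L')
  constructor
  · rintro ⟨⟨hwL, rfl⟩, hws, hwL'⟩
    have hg {a : ℤ} (ha : a ∈ w) : g a.natAbs = a := hL.leftInvOn_invFunOn ⟨hwL a ha, hwL' a ha⟩
    constructor
    · intro i hi
      rw [Finset.mem_coe, ← Finsupp.mem_toMultiset, toMultiset_content, Multiset.mem_coe] at hi
      obtain ⟨a, ha, rfl⟩ := List.mem_map.1 hi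
      exact ⟨a, ⟨hwL a ha, hwL' a ha⟩, rfl⟩
    · rw [toMultiset_content, Multiset.map_coe, List.map_map,
        List.map_congr_left fun a ha => by exact hg ha, List.map_id', Multiset.coe_sort,
        List.mergeSort_of_pairwise (by simpa using hws)]
  · rintro ⟨hm, rfl⟩
    have hg {i : ℕ} (hi : i ∈ Finsupp.toMultiset m) : g i ∈ L ∩ L' ∧ (g i).natAbs = i :=
      Function.invFunOn_pos (hm (Finsupp.mem_toMultiset m i |>.1 hi))
    have hmem : ∀ a ∈ ((Finsupp.toMultiset m).map g).sort (· ≤ ·), a ∈ L ∩ L' := by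
      intro a ha
      obtain ⟨i, hi, rfl⟩ := Multiset.mem_map.1 ((Multiset.mem_sort _).1 ha)
      exact (hg hi).1
    refine ⟨⟨fun a ha => (hmem a ha).1, ?_⟩, Multiset.pairwise_sort _ _,
      fun a ha => (hmem a ha).2⟩
    rw [content, ← Multiset.map_coe, Multiset.sort_eq, Multiset.map_map,
      Multiset.map_congr rfl fun i hi => by exact (hg hi).2, Multiset.map_id',
      Finsupp.toMultiset_toFinsupp]

theorem commutize_ncSorted {L L' : Set ℤ} (hL : Set.InjOn Int.natAbs (L ∩ L')) (k : ℕ) :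
    commutize L (ncSorted L' k) = complete ℤ (Int.natAbs '' (L ∩ L')) k := by
  classical
  ext m
  set w₀ := ((Finsupp.toMultiset m).map (Function.invFunOn Int.natAbs (L ∩ L'))).sort (· ≤ ·)
  have hw (w : List ℤ) : (w ∈ words L m ∧ w.length = k ∧ w.Pairwise (· ≤ ·) ∧ ∀ a ∈ w, a ∈ L') ↔
      w = w₀ ∧ m.degree = k ∧ (m.support : Set ℕ) ⊆ Int.natAbs '' (L ∩ L') := by
    have hlen (h : w ∈ words L m) : w.length = m.degree := by rw [← h.2, degree_content]
    have := mem_words_and_sorted_iff hL m w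
    grind
  simp only [coeff_commutize, coeff_complete, ncSorted, Set.indicator_apply, Set.mem_ofPred_eq,
    Pi.one_apply, sum_boole]
  split_ifs with h
  · rw [card_eq_one.2 ⟨w₀, by ext w; simp [hw, h]⟩, Nat.cast_one]
  · rw [card_eq_zero.2 (by ext w; simp [hw, h]), Nat.cast_zero]

/-! ### The generators of `Sym` and `Symᴮ` -/

section generators

variable (R : Type*) [CommRing R]

/-- The complete homogeneous series in `x₁, x₂, …`, the generators of `Sym`. -/
abbrev hPos (k : ℕ) : MvPowerSeries ℕ R := complete R (Set.Ioi 0) k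

/-- The complete homogeneous series in `x₀, x₁, x₂, …`. -/
abbrev hAll (k : ℕ) : MvPowerSeries ℕ R := complete R Set.univ k

/-- The complete homogeneous series in the variables `x₀, x₁, x₁, x₂, x₂, …`, in which every
variable except `x₀` occurs twice. -/
def hDbl (k : ℕ) : MvPowerSeries ℕ R := ∑ p ∈ antidiagonal k, hPos R p.1 * hAll R p.2

/-- `hᴮ_α` over an arbitrary ring of coefficients. -/
def hBOver (α : PseudoComp) : MvPowerSeries ℕ R := hAll R α.head * (α.tail.map (hDbl R)).prod

theorem map_hDbl (k : ℕ) : MvPowerSeries.map (Int.castRingHom R) (hDbl ℤ k) = hDbl R k := by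
  simp [hDbl, map_complete]

theorem map_hBOver (α : PseudoComp) :
    MvPowerSeries.map (Int.castRingHom R) (hBOver ℤ α) = hBOver R α := by
  simp [hBOver, map_complete, map_list_prod, Function.comp_def, map_hDbl]

theorem hBOver_toPart (α : PseudoComp) : hBOver R α.toPart.1 = hBOver R α :=
  congrArg (hAll R α.head * ·) ((List.perm_insertionSort _ α.tail).map _).prod_eq

end generators

theorem commutize_ncSorted_univ {L : Set ℤ} (hL : Set.InjOn Int.natAbs L) (k : ℕ) :
    commutize Set.univ (ncSorted L k) = complete ℤ (Int.natAbs '' L) k := by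
  rw [commutize_ncSorted (by rwa [Set.univ_inter]), Set.univ_inter]

theorem image_natAbs_Ioi : Int.natAbs '' Set.Ioi 0 = Set.Ioi 0 :=
  Set.Subset.antisymm (by rintro _ ⟨a, ha, rfl⟩; exact Int.natAbs_pos.2 (ne_of_gt ha))
    fun i hi => ⟨i, by simpa using hi, rfl⟩

theorem image_natAbs_Iio : Int.natAbs '' Set.Iio 0 = Set.Ioi 0 :=
  Set.Subset.antisymm (by rintro _ ⟨a, ha, rfl⟩; exact Int.natAbs_pos.2 (ne_of_lt ha))
    fun i hi => ⟨-i, by simpa using hi, by simp⟩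

theorem image_natAbs_Ici : Int.natAbs '' Set.Ici 0 = Set.univ :=
  Set.eq_univ_of_forall fun i => ⟨i, by simp, rfl⟩

theorem injOn_natAbs_Ici : Set.InjOn Int.natAbs (Set.Ici 0) := by
  intro a ha b hb h
  simp only [Set.mem_Ici] at ha hb
  omega

theorem injOn_natAbs_Iio : Set.InjOn Int.natAbs (Set.Iio 0) := by
  intro a ha b hb h
  simp only [Set.mem_Iio] at ha hb
  omega

theorem chi_ncH (k : ℕ) : chi (ncH k) = hPos ℤ k := by
  rw [chi, ncH_eq_ncSorted, commutize_ncSorted, Set.inter_univ, image_natAbs_Ioi]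
  exact injOn_natAbs_Ici.mono (Set.inter_subset_left.trans Set.Ioi_subset_Ici_self)

theorem chiB_ncHB (k : ℕ) : chiB (ncHB k) = hAll ℤ k := by
  rw [chiB, ncHB_eq_ncSorted, commutize_ncSorted_univ injOn_natAbs_Ici, image_natAbs_Ici]

theorem chiB_ncH (k : ℕ) : chiB (ncH k) = hDbl ℤ k := by
  have hsplit : ncH k = ∑ p ∈ antidiagonal k, ncMul (ncSorted (Set.Iio 0) p.1) (ncHB p.2) := by
    simp only [ncH_eq_ncSorted, ncHB_eq_ncSorted]
    rw [← Set.Iio_union_Ici (a := (0 : ℤ))]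
    exact ncSorted_union (fun _ ha _ hb => (Set.mem_Iio.1 ha).trans_le (Set.mem_Ici.1 hb)) k
  rw [hsplit, map_sum, hDbl]
  refine sum_congr rfl fun p _ => ?_
  rw [← chiB_ncHB, chiB, commutize_ncMul, commutize_ncSorted_univ injOn_natAbs_Iio,
    image_natAbs_Iio]

theorem hAll_eq_sum (R : Type*) [CommRing R] (k : ℕ) :
    hAll R k = ∑ p ∈ antidiagonal k, (X 0 : MvPowerSeries ℕ R) ^ p.1 * hPos R p.2 := by
  have hsplit : ncHB k =
      ∑ p ∈ antidiagonal k, ncMul (ncSorted {0} p.1) (ncSorted (Set.Ioi 0) p.2) := by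
    rw [ncHB_eq_ncSorted, ← ncSorted_union (by simp), ← Set.Ioi_insert, Set.singleton_union]
  have hInt := congrArg (MvPowerSeries.map (Int.castRingHom R) ∘ chiB) hsplit
  have hterm (p : ℕ × ℕ) : chiB (ncMul (ncSorted {0} p.1) (ncSorted (Set.Ioi 0) p.2)) =
      (X 0 : MvPowerSeries ℕ ℤ) ^ p.1 * hPos ℤ p.2 := by
    rw [chiB, commutize_ncMul, commutize_ncSorted_univ (Set.injOn_singleton _ _),
      commutize_ncSorted_univ (injOn_natAbs_Ici.mono Set.Ioi_subset_Ici_self), image_natAbs_Ioi,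
      Set.image_singleton, Int.natAbs_zero, complete_singleton]
  simpa [chiB_ncHB, map_complete, hterm] using hInt

theorem hB_eq (α : PseudoComp) : hB α = hBOver ℤ α := by
  rw [hB, ncHBComp, chiB, commutize_foldl_ncMul, List.map_map, hBOver, ← chiB_ncHB]
  exact congrArg (_ * List.prod ·) (List.map_congr_left fun k _ => chiB_ncH k)

theorem chi_ncHComp (α : Comp) : chi (ncHComp α) = (α.1.map (hPos ℤ)).prod := by
  rw [ncHComp, chi, commutize_foldl_ncMul, commutize_ncOne, one_mul, List.map_map]
  exact congrArg List.prod (List.map_congr_left fun k _ => chi_ncH k)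

theorem symF_eq_span :
    SymF = Submodule.span ℤ (Set.range fun α : Comp => (α.1.map (hPos ℤ)).prod) := by
  rw [SymF, NSym, Submodule.map_span, ← Set.range_comp]
  exact congrArg (fun f => Submodule.span ℤ (Set.range f)) (funext chi_ncHComp)

theorem symB_eq_span : SymB = Submodule.span ℤ (Set.range (hBOver ℤ)) := by
  rw [SymB, NSymB, Submodule.map_span, ← Set.range_comp]
  exact congrArg (fun f => Submodule.span ℤ (Set.range f)) (funext hB_eq)

/-! ### Pseudo-compositions and their descent sets -/

namespace PseudoComp

/-- The pseudo-composition `(n)` with a single part, the base case of `snoc_induction`. -/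
def single (n : ℕ) : PseudoComp := ⟨n, [], by simp⟩

/-- The pseudo-composition `(α₁, …, α_ℓ, k)`.  Parts are appended at the end because this adds just
`|α|` to the descent set. -/
def snoc (α : PseudoComp) (k : ℕ) (hk : 0 < k) : PseudoComp :=
  ⟨α.head, α.tail ++ [k], by simpa [or_imp, forall_and, hk] using α.tail_pos⟩

@[elab_as_elim]
theorem snoc_induction {P : PseudoComp → Prop} (single : ∀ n, P (single n))
    (snoc : ∀ α k hk, P α → P (snoc α k hk)) (α : PseudoComp) : P α := by
  obtain ⟨n, t, ht⟩ := α
  induction t using List.reverseRecOn with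
  | nil => exact single n
  | append_singleton t k ih =>
    exact snoc ⟨n, t, fun a ha => ht a (List.mem_append_left _ ha)⟩ k (ht k (by simp)) (ih _)

@[simp] theorem size_single (n : ℕ) : (single n).size = n := by simp [single, size]

@[simp] theorem size_snoc (α : PseudoComp) (k hk) : (snoc α k hk).size = α.size + k := by
  simp [snoc, size, add_assoc]

@[simp] theorem descents_single (n : ℕ) : (single n).descents = ∅ := by simp [single, descents]

@[simp] theorem descents_snoc (α : PseudoComp) (k hk) :
    (snoc α k hk).descents = insert α.size α.descents := by
  rw [snoc, descents, descents]
  simp only [List.length_append, List.length_singleton, range_add_one, image_insert]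
  congr 1
  · rw [List.take_append_of_le_length le_rfl, List.take_length, size]
  · refine image_congr fun i hi => ?_
    rw [List.take_append_of_le_length (mem_range.1 hi).le]

theorem descents_subset_range (α : PseudoComp) : α.descents ⊆ range α.size := by
  induction α using snoc_induction with
  | single n => simp
  | snoc α k hk ih =>
    rw [descents_snoc, size_snoc, insert_subset_iff, mem_range]
    exact ⟨Nat.lt_add_of_pos_right hk, ih.trans (range_mono (Nat.le_add_right _ _))⟩

theorem lt_size_of_mem_descents {α : PseudoComp} {d : ℕ} (hd : d ∈ α.descents) : d < α.size :=
  mem_range.1 (α.descents_subset_range hd)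

theorem size_notMem_descents (α : PseudoComp) : α.size ∉ α.descents :=
  fun h => (lt_size_of_mem_descents h).false

theorem length_eq_card_descents (α : PseudoComp) : α.length = α.descents.card + 1 := by
  induction α using snoc_induction with
  | single n => simp [single, length, descents]
  | snoc α k hk ih =>
    rw [descents_snoc, card_insert_of_notMem α.size_notMem_descents, ← ih]
    simp [snoc, length]

theorem eq_of_size_of_descents {α β : PseudoComp} (h : α.size = β.size)
    (hD : α.descents = β.descents) : α = β := by
  induction α using snoc_induction generalizing β with
  | single n =>
    cases β using snoc_induction with
    | single m => exact congrArg PseudoComp.single (by simpa using h)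
    | snoc β l hl => exact absurd hD.symm (by simp)
  | snoc α k hk ih =>
    cases β using snoc_induction with
    | single m => exact absurd hD (by simp)
    | snoc β l hl =>
      simp only [descents_snoc, size_snoc] at h hD
      have hsize : α.size = β.size := by
        have hα : α.size ∈ insert β.size β.descents := hD ▸ mem_insert_self _ _
        have hβ : β.size ∈ insert α.size α.descents := hD ▸ mem_insert_self _ _
        have := @lt_size_of_mem_descents α β.size
        have := @lt_size_of_mem_descents β α.size
        grind
      have hdesc : α.descents = β.descents := by
        rw [← erase_insert α.size_notMem_descents, hD, hsize,
          erase_insert β.size_notMem_descents]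
      obtain rfl := ih hsize hdesc
      obtain rfl : k = l := by omega
      rfl

theorem exists_size_eq_descents_eq (n : ℕ) {S : Finset ℕ} (hS : S ⊆ range n) :
    ∃ α : PseudoComp, α.size = n ∧ α.descents = S := by
  induction n using Nat.strong_induction_on generalizing S with
  | _ n ih =>
    rcases S.eq_empty_or_nonempty with rfl | hne
    · exact ⟨single n, by simp⟩
    · set d := S.max' hne
      have hd : d ∈ S := S.max'_mem hne
      have hdn : d < n := mem_range.1 (hS hd)
      obtain ⟨α, hsize, hdesc⟩ := ih d hdn (S := S.erase d)
        fun c hc => mem_range.2 (S.lt_max'_of_mem_erase_max' hne hc)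
      refine ⟨snoc α (n - d) (by omega), by rw [size_snoc]; omega, ?_⟩
      rw [descents_snoc, hsize, hdesc, insert_erase hd]

theorem finite_setOf_size_le (N : ℕ) : {α : PseudoComp | α.size ≤ N}.Finite := by
  refine Set.Finite.of_injOn (f := fun α : PseudoComp => (α.size, α.descents))
    (t := ((range (N + 1) ×ˢ (range N).powerset : Finset _) : Set _)) (fun α hα => ?_) ?_
    (finite_toSet _)
  · have hα : α.size ≤ N := hα
    simp only [mem_coe, mem_product, mem_range, mem_powerset]
    exact ⟨by omega, α.descents_subset_range.trans (range_mono hα)⟩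
  · exact fun α _ β _ h => eq_of_size_of_descents (congrArg Prod.fst h) (congrArg Prod.snd h)

theorem toPart_eq_iff (α : PseudoComp) (l : PseudoPart) :
    α.toPart = l ↔ α.head = l.1.head ∧ α.tail.Perm l.1.tail := by
  constructor
  · rintro rfl
    exact ⟨rfl, (List.perm_insertionSort _ _).symm⟩
  · rintro ⟨hhead, htail⟩
    refine Subtype.ext (PseudoComp.ext hhead ?_)
    exact ((List.perm_insertionSort _ _).trans htail).eq_of_pairwise
      (fun a b _ _ h h' => le_antisymm h' h) (List.pairwise_insertionSort _ _) l.2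

theorem toPart_val (l : PseudoPart) : l.1.toPart = l :=
  (toPart_eq_iff _ _).2 ⟨rfl, List.Perm.refl _⟩

theorem size_toPart (α : PseudoComp) : α.toPart.1.size = α.size := by
  obtain ⟨hhead, htail⟩ := (toPart_eq_iff α _).1 rfl
  rw [size, size, ← hhead, htail.sum_eq]

end PseudoComp

theorem finite_setOf_partSize_eq (n : ℕ) : {l : PseudoPart | l.1.size = n}.Finite :=
  ((PseudoComp.finite_setOf_size_le n).preimage Subtype.val_injective.injOn).subset
    fun _ h => le_of_eq h

/-! ### The shape of a monomial -/

/-- The positive indices of the variables occurring in a monomial. -/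
def posSupp (m : ℕ →₀ ℕ) : Finset ℕ := m.support.erase 0

theorem mem_posSupp {m : ℕ →₀ ℕ} {c : ℕ} : c ∈ posSupp m ↔ c ≠ 0 ∧ m c ≠ 0 := by
  simp [posSupp]

/-- The nonzero exponents of `x₁, x₂, …` in a monomial. -/
def posValues (m : ℕ →₀ ℕ) : Multiset ℕ := (posSupp m).val.map m

theorem pos_of_mem_posValues {m : ℕ →₀ ℕ} {a : ℕ} (ha : a ∈ posValues m) : 0 < a := by
  obtain ⟨c, hc, rfl⟩ := Multiset.mem_map.1 ha
  exact Nat.pos_of_ne_zero (mem_posSupp.1 hc).2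

/-- The exponents of a monomial as a pseudo-composition: first the exponent of `x₀`, then the
nonzero exponents of `x₁, x₂, …` by increasing index. -/
def exponents (m : ℕ →₀ ℕ) : PseudoComp :=
  ⟨m 0, ((posSupp m).sort (· ≤ ·)).map m, fun a ha => pos_of_mem_posValues (m := m) (by
    rwa [posValues, ← sort_eq _ (· ≤ ·), Multiset.map_coe])⟩

/-- The pseudo-partition of the exponents of a monomial. -/
def shape (m : ℕ →₀ ℕ) : PseudoPart := (exponents m).toPart

theorem coe_tail_exponents (m : ℕ →₀ ℕ) : ((exponents m).tail : Multiset ℕ) = posValues m := by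
  rw [exponents, ← Multiset.map_coe, sort_eq, posValues]

theorem shape_eq_iff (m : ℕ →₀ ℕ) (l : PseudoPart) :
    shape m = l ↔ m 0 = l.1.head ∧ posValues m = l.1.tail := by
  rw [shape, PseudoComp.toPart_eq_iff, ← coe_tail_exponents, Multiset.coe_eq_coe, exponents]

theorem shape_head (m : ℕ →₀ ℕ) : (shape m).1.head = m 0 := ((shape_eq_iff m _).1 rfl).1.symm

theorem coe_shape_tail (m : ℕ →₀ ℕ) : ((shape m).1.tail : Multiset ℕ) = posValues m :=
  ((shape_eq_iff m _).1 rfl).2.symm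

theorem shape_eq_shape_iff {m n : ℕ →₀ ℕ} :
    shape m = shape n ↔ m 0 = n 0 ∧ posValues m = posValues n := by
  rw [shape_eq_iff, shape_head, coe_shape_tail]

theorem size_shape (m : ℕ →₀ ℕ) : (shape m).1.size = m.degree := by
  have hsum : (shape m).1.tail.sum = ∑ c ∈ posSupp m, m c := by
    rw [← Multiset.sum_coe, coe_shape_tail, posValues, sum_map_val]
  rw [PseudoComp.size, shape_head, hsum, posSupp, Finsupp.degree_apply]
  by_cases h0 : 0 ∈ m.support
  · exact add_sum_erase _ _ h0
  · rw [Finsupp.notMem_support_iff.1 h0, zero_add, erase_eq_of_notMem h0]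

theorem posValues_add_single {m : ℕ →₀ ℕ} {c b : ℕ} (hc : c ≠ 0) (hb : b ≠ 0) (hm : m c = 0) :
    posValues (m + Finsupp.single c b) = b ::ₘ posValues m := by
  have hsupp : posSupp (m + Finsupp.single c b) = insert c (posSupp m) := by
    ext d
    by_cases hd : d = c <;> simp [mem_posSupp, hd, hc, hb]
  have hcm : c ∉ posSupp m := fun h => (mem_posSupp.1 h).2 hm
  rw [posValues, hsupp, insert_val_of_notMem hcm, Multiset.map_cons, posValues]
  refine congrArg₂ _ (by simp [hm]) (Multiset.map_congr rfl fun d hd => ?_)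
  have hdc : d ≠ c := fun h => hcm (h ▸ hd)
  simp [Finsupp.single_eq_of_ne hdc]

theorem card_posValues_add_single {m : ℕ →₀ ℕ} {c : ℕ} (hm : m c ≠ 0) (b : ℕ) :
    (posValues (m + Finsupp.single c b)).card = (posValues m).card := by
  have hsupp : posSupp (m + Finsupp.single c b) = posSupp m := by
    ext d
    by_cases hd : d = c <;> simp [mem_posSupp, hd, hm]
  rw [posValues, posValues, hsupp, Multiset.card_map, Multiset.card_map]

theorem exists_shape_eq (l : PseudoPart) : ∃ m, shape m = l := by
  simp_rw [shape_eq_iff]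
  have hpos : ∀ a ∈ (l.1.tail : Multiset ℕ), 0 < a := l.1.tail_pos
  generalize (l.1.tail : Multiset ℕ) = s at hpos
  induction s using Multiset.induction_on with
  | empty =>
    refine ⟨Finsupp.single 0 l.1.head, by simp, Multiset.map_eq_zero.2 (val_eq_zero.2 ?_)⟩
    ext c
    simp +contextual [mem_posSupp, Finsupp.single_apply, eq_comm]
  | cons b s ih =>
    obtain ⟨m, hm0, hms⟩ := ih fun a ha => hpos a (Multiset.mem_cons_of_mem ha)
    obtain ⟨c, hc⟩ := Infinite.exists_notMem_finset (insert 0 m.support)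
    obtain ⟨hc0, hcm⟩ : c ≠ 0 ∧ m c = 0 := by simpa using hc
    refine ⟨m + Finsupp.single c b, by simpa [hc0] using hm0, ?_⟩
    rw [posValues_add_single hc0 (hpos b (Multiset.mem_cons_self b s)).ne' hcm, hms]

theorem exists_perm_of_shape_eq {m n : ℕ →₀ ℕ} (h : shape m = shape n) :
    ∃ π : Equiv.Perm ℕ, π 0 = 0 ∧ ∀ c, n (π c) = m c := by
  obtain ⟨h0, hval⟩ := shape_eq_shape_iff.1 h
  have hperm : ((posSupp m).toList.map m).Perm ((posSupp n).toList.map n) := by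
    rwa [← Multiset.coe_eq_coe, ← Multiset.map_coe, ← Multiset.map_coe, coe_toList, coe_toList]
  obtain ⟨t, hmap, ht⟩ : Relation.Comp (· = List.map n ·) List.Perm
      ((posSupp m).toList.map m) (posSupp n).toList := by
    rw [List.eq_map_comp_perm]
    exact hperm
  set s := (posSupp m).toList
  have hlen : (0 :: s).length = (0 :: t).length := by simpa using congrArg List.length hmap
  have hs : (0 :: s).Nodup := List.nodup_cons.2 ⟨by simp [s, mem_posSupp], nodup_toList _⟩
  have htn : (0 :: t).Nodup := List.nodup_cons.2
    ⟨by simp [ht.mem_iff, mem_posSupp], ht.nodup_iff.2 (nodup_toList _)⟩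
  have := Equiv.Perm.isMultiplyPretransitive ℕ (0 :: s).length
  obtain ⟨π, hπ⟩ := MulAction.exists_smul_eq (Equiv.Perm ℕ) (⟨_, hs.injective_get⟩ : _ ↪ ℕ)
    ⟨_, htn.injective_get.comp (finCongr hlen).injective⟩
  have hst : (0 :: s).map π = 0 :: t := List.ext_get (by simpa using hlen) fun i hi _ => by
    rw [List.get_eq_getElem, List.getElem_map]
    exact DFunLike.congr_fun hπ ⟨i, by simpa using hi⟩
  obtain ⟨hπ0, rfl⟩ : π 0 = 0 ∧ s.map π = t := by simpa using hst
  refine ⟨π, hπ0, fun c => ?_⟩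
  by_cases hc0 : c = 0
  · rw [hc0, hπ0, h0]
  by_cases hcs : c ∈ s
  · rw [List.map_map] at hmap
    exact (List.map_inj_left.1 hmap c hcs).symm
  · have hm : m c = 0 := by simpa [s, mem_posSupp, hc0] using hcs
    have hn : π c ∉ posSupp n := by
      rwa [← mem_toList, ← ht.mem_iff, List.mem_map_of_injective π.injective]
    rw [hm]
    by_contra hne
    exact hn (mem_posSupp.2 ⟨fun h => hc0 (π.injective (h.trans hπ0.symm)), hne⟩)

/-! ### Monomial series -/

/-- The monomial series `mᴮ_l` over `R`: the sum of all monomials of shape `l`. -/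
def mOver (R : Type*) [CommRing R] (l : PseudoPart) : MvPowerSeries ℕ R :=
  Set.indicator {m : ℕ →₀ ℕ | shape m = l} 1

open scoped Classical in
theorem coeff_mOver (R : Type*) [CommRing R] (l : PseudoPart) (m : ℕ →₀ ℕ) :
    coeff m (mOver R l) = if shape m = l then 1 else 0 := by
  rw [coeff_apply, mOver, Set.indicator_apply]
  rfl

theorem single_add_sum_single_eq_iff {k : ℕ} {i t : Fin k → ℕ} (hi : Function.Injective i)
    (hi0 : ∀ j, i j ≠ 0) (ht : ∀ j, t j ≠ 0) (a : ℕ) (m : ℕ →₀ ℕ) :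
    Finsupp.single 0 a + ∑ j, Finsupp.single (i j) (t j) = m ↔
      a = m 0 ∧ (∀ j, t j = m (i j)) ∧ (posSupp m : Set ℕ) = Set.range i := by
  set n := Finsupp.single 0 a + ∑ j, Finsupp.single (i j) (t j)
  have hn0 : n 0 = a := by simp [n, hi0]
  have hni (j) : n (i j) = t j := by simp [n, (hi0 _).symm, Finsupp.single_apply, hi.eq_iff]
  have hnc {c} (hc : c ≠ 0) (hci : c ∉ Set.range i) : n c = 0 := by
    simp only [Set.mem_range, not_exists] at hci
    simp [n, hc.symm, hci]
  constructor
  · intro h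
    rw [← h]
    refine ⟨hn0.symm, fun j => (hni j).symm, Set.Subset.antisymm (fun c hc => ?_) ?_⟩
    · obtain ⟨hc0, hnc0⟩ := mem_posSupp.1 hc
      exact by_contra fun hci => hnc0 (hnc hc0 hci)
    · rintro _ ⟨j, rfl⟩
      exact mem_posSupp.2 ⟨hi0 j, (hni j).trans_ne (ht j)⟩
  · rintro ⟨h0, hmi, hrange⟩
    ext c
    by_cases hc0 : c = 0
    · rw [hc0, hn0, h0]
    by_cases hci : c ∈ Set.range i
    · obtain ⟨j, rfl⟩ := hci
      rw [hni, hmi]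
    · rw [hnc hc0 hci]
      rw [← hrange, mem_coe, mem_posSupp] at hci
      exact (by_contra fun h => hci ⟨hc0, Ne.symm h⟩)

theorem ofFn_eq_sort {k : ℕ} {i : Fin k → ℕ} (hi : StrictMono i) {s : Finset ℕ}
    (hs : (s : Set ℕ) = Set.range i) : List.ofFn i = s.sort (· ≤ ·) := by
  have hs' : s = (List.ofFn i).toFinset := by
    ext c
    rw [← mem_coe, hs, List.mem_toFinset, List.mem_ofFn, Set.mem_range]
  rw [hs', (List.toFinset_sort _ (List.nodup_ofFn.2 hi.injective)).2]
  exact List.pairwise_ofFn.2 fun _ _ hab => (hi hab).le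

theorem strictMono_of_ofFn_eq_sort {k : ℕ} {i : Fin k → ℕ} {s : Finset ℕ}
    (h : List.ofFn i = s.sort (· ≤ ·)) : StrictMono i :=
  fun _ _ hab => List.pairwise_ofFn.1 (h ▸ (sortedLT_sort s).pairwise) hab

theorem mem_of_ofFn_eq_sort {k : ℕ} {i : Fin k → ℕ} {s : Finset ℕ}
    (h : List.ofFn i = s.sort (· ≤ ·)) (c : ℕ) : c ∈ s ↔ ∃ j, i j = c := by
  rw [← mem_sort (· ≤ ·), ← h, List.mem_ofFn]

/-- The only index tuple that contributes to the coefficient of a monomial in `Mᴮ_α` is the sorted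
list of its variables. -/
theorem MB_index_iff (α : PseudoComp) (m : ℕ →₀ ℕ) (i : Fin α.tail.length → ℕ) :
    (StrictMono i ∧ (∀ j, 0 < i j) ∧
        Finsupp.single 0 α.head + ∑ j, Finsupp.single (i j) (α.tail.get j) = m) ↔
      α = exponents m ∧ List.ofFn i = (posSupp m).sort (· ≤ ·) := by
  have htail : (∀ j, α.tail.get j = m (i j)) ↔ α.tail = (List.ofFn i).map m := by
    have hfun : (∀ j, α.tail.get j = m (i j)) ↔ α.tail.get = m ∘ i := funext_iff.symm
    rw [List.map_ofFn, hfun, ← List.ofFn_injective.eq_iff, List.ofFn_get]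
  have ht (j) : α.tail.get j ≠ 0 := (α.tail_pos _ (List.get_mem _ j)).ne'
  constructor
  · rintro ⟨hi, hi0, h⟩
    rw [single_add_sum_single_eq_iff hi.injective (fun j => (hi0 j).ne') ht, htail] at h
    obtain ⟨hhead, htail, hrange⟩ := h
    have hsort := ofFn_eq_sort hi hrange
    exact ⟨PseudoComp.ext hhead (htail.trans (by rw [hsort]; rfl)), hsort⟩
  · rintro ⟨hα, hsort⟩
    have hmem := mem_of_ofFn_eq_sort hsort
    have hi := strictMono_of_ofFn_eq_sort hsort
    have hi0 (j) : i j ≠ 0 := (mem_posSupp.1 ((hmem _).2 ⟨j, rfl⟩)).1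
    refine ⟨hi, fun j => Nat.pos_of_ne_zero (hi0 j), ?_⟩
    rw [single_add_sum_single_eq_iff hi.injective hi0 ht, htail, hsort]
    exact ⟨congrArg PseudoComp.head hα, congrArg PseudoComp.tail hα, Set.ext hmem⟩

open scoped Classical in
theorem MB_apply (α : PseudoComp) (m : ℕ →₀ ℕ) : MB α m = if α = exponents m then 1 else 0 := by
  simp only [MB, MB_index_iff]
  split_ifs with h
  · have hlen : α.tail.length = ((posSupp m).sort (· ≤ ·)).length := by
      rw [h, exponents, List.length_map]
    rw [Nat.cast_eq_one, Nat.card_eq_one_iff_exists]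
    refine ⟨⟨fun j => ((posSupp m).sort (· ≤ ·)).get (j.cast hlen), h, ?_⟩, fun i => Subtype.ext ?_⟩
    · exact List.ext_get (by simp [hlen]) (by simp)
    · refine List.ofFn_injective (i.2.2.trans ?_)
      exact List.ext_get (by simp [hlen]) (by simp)
  · simp [h]

theorem mB_eq (l : PseudoPart) : mB l = mOver ℤ l := by
  classical
  have hfin : {α : PseudoComp | α.toPart = l}.Finite :=
    (PseudoComp.finite_setOf_size_le l.1.size).subset fun α hα => by
      rw [Set.mem_ofPred_eq, ← hα, α.size_toPart]
  ext m
  rw [mB, finsum_mem_eq_finite_toFinset_sum _ hfin, map_sum, coeff_mOver]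
  simp only [coeff_apply, MB_apply, shape, sum_ite_eq', Set.Finite.mem_toFinset]
  exact if_congr Iff.rfl rfl rfl

theorem map_mOver (R : Type*) [CommRing R] (l : PseudoPart) :
    MvPowerSeries.map (Int.castRingHom R) (mOver ℤ l) = mOver R l := by
  ext m
  simp [coeff_mOver]

/-! ### Symmetric series of type B -/

theorem shape_embDomain {π : Equiv.Perm ℕ} (hπ : π 0 = 0) (m : ℕ →₀ ℕ) :
    shape (m.embDomain π.toEmbedding) = shape m := by
  have happly (c : ℕ) : m.embDomain π.toEmbedding (π c) = m c :=
    Finsupp.embDomain_apply_self π.toEmbedding m c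
  have hsupp : posSupp (m.embDomain π.toEmbedding) = (posSupp m).map π.toEmbedding := by
    ext c
    obtain ⟨c, rfl⟩ := π.surjective c
    have hc : π c ≠ 0 ↔ c ≠ 0 := by simpa [hπ] using π.injective.ne_iff (x := c) (y := 0)
    rw [mem_posSupp, happly, hc, ← mem_posSupp]
    exact (mem_map' π.toEmbedding).symm
  rw [shape_eq_shape_iff, ← hπ, happly, posValues, hsupp, map_val, Multiset.map_map, hπ]
  exact ⟨rfl, Multiset.map_congr rfl fun c _ => happly c⟩

theorem rename_eq_self {R : Type*} [CommRing R] {f : MvPowerSeries ℕ R}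
    (hf : ∀ m n, shape m = shape n → coeff m f = coeff n f) {π : Equiv.Perm ℕ} (hπ : π 0 = 0) :
    rename π f = f := by
  ext n
  obtain ⟨m, rfl⟩ : ∃ m : ℕ →₀ ℕ, m.embDomain π.toEmbedding = n :=
    ⟨n.equivMapDomain π.symm, Finsupp.ext fun c => by
      obtain ⟨c, rfl⟩ := π.surjective c
      exact Finsupp.embDomain_apply_self π.toEmbedding _ c⟩
  exact (coeff_embDomain_rename π.toEmbedding f m).trans (hf _ _ (shape_embDomain hπ m).symm)

section symAlg

variable (R : Type*) [CommRing R]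

/-- The series that are symmetric in `x₁, x₂, …`, the variable `x₀` playing no special role: the
coefficient of a monomial depends only on its shape.  The degree is not bounded. -/
def symAlg : Subalgebra R (MvPowerSeries ℕ R) where
  carrier := {f | ∀ m n, shape m = shape n → coeff m f = coeff n f}
  add_mem' hf hg m n h := by rw [map_add, map_add, hf m n h, hg m n h]
  mul_mem' {f g} hf hg m n h := by
    obtain ⟨π, hπ0, hπ⟩ := exists_perm_of_shape_eq h
    have hn : n = m.embDomain π.toEmbedding := Finsupp.ext fun c => by
      obtain ⟨c, rfl⟩ := π.surjective c
      exact (hπ c).trans (Finsupp.embDomain_apply_self π.toEmbedding m c).symm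
    calc coeff m (f * g) = coeff n (rename π (f * g)) := by
          rw [hn]
          exact (coeff_embDomain_rename π.toEmbedding (f * g) m).symm
      _ = coeff n (f * g) := by rw [map_mul, rename_eq_self hf hπ0, rename_eq_self hg hπ0]
  algebraMap_mem' r m n h := by
    classical
    have hdeg : m.degree = n.degree := by rw [← size_shape, h, size_shape]
    rw [MvPowerSeries.algebraMap_apply, Algebra.algebraMap_self, RingHom.id_apply]
    simp only [coeff_C, ← Finsupp.degree_eq_zero_iff, hdeg]

variable {R}

theorem coeff_eq_of_shape_eq {f : MvPowerSeries ℕ R} (hf : f ∈ symAlg R) {m n : ℕ →₀ ℕ}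
    (h : shape m = shape n) : coeff m f = coeff n f :=
  hf m n h

theorem mOver_mem_symAlg (l : PseudoPart) : mOver R l ∈ symAlg R := fun m n h => by
  rw [coeff_mOver, coeff_mOver, h]

theorem isHomogeneous_iff_degree {σ : Type*} {f : MvPowerSeries σ R} {n : ℕ} :
    f.IsHomogeneous n ↔ ∀ m, coeff m f ≠ 0 → m.degree = n := by
  rw [Finsupp.degree_eq_weight_one]
  rfl

theorem isHomogeneous_mOver (l : PseudoPart) : (mOver R l).IsHomogeneous l.1.size := by
  classical
  refine isHomogeneous_iff_degree.2 fun m hm => ?_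
  rw [coeff_mOver, ite_ne_right_iff] at hm
  exact (size_shape m).symm.trans (congrArg (·.1.size) hm.1)

theorem isHomogeneous_complete {σ : Type*} (S : Set σ) (k : ℕ) :
    (complete R S k).IsHomogeneous k := by
  classical
  refine isHomogeneous_iff_degree.2 fun m hm => ?_
  rw [coeff_complete, ite_ne_right_iff] at hm
  exact hm.1.1

theorem hAll_mem_symAlg (k : ℕ) : hAll R k ∈ symAlg R := fun m n h => by
  classical
  simp [coeff_complete, ← size_shape, h]

theorem support_subset_Ioi_iff (m : ℕ →₀ ℕ) : (m.support : Set ℕ) ⊆ Set.Ioi 0 ↔ m 0 = 0 := by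
  refine ⟨fun h => by_contra fun h0 => lt_irrefl 0 (h (Finsupp.mem_support_iff.2 h0)), ?_⟩
  intro h c hc
  refine Nat.pos_of_ne_zero ?_
  rintro rfl
  exact Finsupp.mem_support_iff.1 hc h

theorem coeff_hPos (k : ℕ) (m : ℕ →₀ ℕ) :
    coeff m (hPos R k) = if m.degree = k ∧ m 0 = 0 then 1 else 0 := by
  classical
  rw [coeff_complete]
  exact if_congr (and_congr_right' (support_subset_Ioi_iff m)) rfl rfl

theorem hPos_zero : hPos R 0 = 1 := by
  classical
  ext m
  simp only [coeff_hPos, coeff_one, Finsupp.degree_eq_zero_iff]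
  exact if_congr (and_iff_left_of_imp fun h => by rw [h]; rfl) rfl rfl

theorem hPos_mem_symAlg (k : ℕ) : hPos R k ∈ symAlg R := fun m n h => by
  simp only [coeff_hPos, ← size_shape, ← shape_head, h]

theorem hDbl_mem_symAlg (k : ℕ) : hDbl R k ∈ symAlg R :=
  sum_mem fun _ _ => mul_mem (hPos_mem_symAlg _) (hAll_mem_symAlg _)

theorem hBOver_mem_symAlg (α : PseudoComp) : hBOver R α ∈ symAlg R :=
  mul_mem (hAll_mem_symAlg _) (list_prod_mem (by simp [hDbl_mem_symAlg]))

theorem isHomogeneous_hDbl (k : ℕ) : (hDbl R k).IsHomogeneous k := by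
  rw [hDbl, isHomogeneous_iff_eq_homogeneousComponent, map_sum]
  refine sum_congr rfl fun p hp => ?_
  rw [← isHomogeneous_iff_eq_homogeneousComponent, ← mem_antidiagonal.1 hp]
  exact IsHomogeneous.mul (isHomogeneous_complete _ _) (isHomogeneous_complete _ _)

theorem hBOver_single (n : ℕ) : hBOver R (.single n) = hAll R n := by
  simp [hBOver, PseudoComp.single]

theorem hBOver_snoc (α : PseudoComp) (k : ℕ) (hk : 0 < k) :
    hBOver R (α.snoc k hk) = hBOver R α * hDbl R k := by
  simp [hBOver, PseudoComp.snoc, mul_assoc]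

theorem isHomogeneous_hBOver (α : PseudoComp) : (hBOver R α).IsHomogeneous α.size := by
  induction α using PseudoComp.snoc_induction with
  | single n =>
    rw [hBOver_single, PseudoComp.size_single]
    exact isHomogeneous_complete _ n
  | snoc α k hk ih =>
    rw [hBOver_snoc, PseudoComp.size_snoc]
    exact IsHomogeneous.mul ih (isHomogeneous_hDbl k)

/-- Some monomial of shape `l`. -/
def monomialOf (l : PseudoPart) : ℕ →₀ ℕ := (exists_shape_eq l).choose

theorem shape_monomialOf (l : PseudoPart) : shape (monomialOf l) = l :=
  (exists_shape_eq l).choose_spec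

open scoped Classical in
theorem coeff_monomialOf_mOver (k l : PseudoPart) :
    coeff (monomialOf k) (mOver R l) = if k = l then 1 else 0 := by
  rw [coeff_mOver, shape_monomialOf]

theorem eq_sum_mOver {f : MvPowerSeries ℕ R} (hf : f ∈ symAlg R) {n : ℕ} (hn : f.IsHomogeneous n) :
    f = ∑ l ∈ (finite_setOf_partSize_eq n).toFinset, coeff (monomialOf l) f • mOver R l := by
  classical
  ext m
  have hcoeff (l : PseudoPart) : coeff m (coeff (monomialOf l) f • mOver R l) =
      if shape m = l then coeff m f else 0 := by
    rw [map_smul, coeff_mOver, smul_eq_mul, mul_ite, mul_one, mul_zero]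
    refine ite_congr rfl (fun h => coeff_eq_of_shape_eq hf ?_) fun _ => rfl
    rw [shape_monomialOf, h]
  rw [map_sum, sum_congr rfl fun l _ => hcoeff l, sum_ite_eq]
  simp only [Set.Finite.mem_toFinset, Set.mem_ofPred_eq, size_shape]
  split_ifs with h
  · rfl
  · exact hn.coeff_eq_zero h

theorem linearIndependent_mOver : LinearIndependent R (mOver R) := by
  classical
  rw [linearIndependent_iff']
  intro s g hg l hl
  simpa [coeff_monomialOf_mOver, hl] using congrArg (coeff (monomialOf l)) hg

theorem mem_span_mOver {f : MvPowerSeries ℕ R} (hf : f ∈ symAlg R) {n : ℕ}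
    (hn : f.IsHomogeneous n) : f ∈ Submodule.span R (mOver R '' {l | l.1.size = n}) := by
  rw [eq_sum_mOver hf hn]
  exact sum_mem fun l hl => Submodule.smul_mem _ _
    (Submodule.subset_span ⟨l, (Set.Finite.mem_toFinset _).1 hl, rfl⟩)

theorem hBOver_mem_span_mOver (α : PseudoComp) :
    hBOver R α ∈ Submodule.span R (mOver R '' {l | l.1.size = α.size}) :=
  mem_span_mOver (hBOver_mem_symAlg α) (isHomogeneous_hBOver α)

theorem prod_hPos_mem_span_mOver (s : List ℕ) :
    (s.map (hPos R)).prod ∈ Submodule.span R (mOver R '' {l | l.1.size = s.sum}) := by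
  refine mem_span_mOver (list_prod_mem fun f hf => ?_) ?_
  · obtain ⟨k, -, rfl⟩ := List.mem_map.1 hf
    exact hPos_mem_symAlg k
  · induction s with
    | nil =>
      refine isHomogeneous_iff_degree.2 fun m hm => ?_
      obtain rfl : m = 0 := by simp_all [coeff_one]
      simp
    | cons k s ih => exact IsHomogeneous.mul (isHomogeneous_complete _ k) ih

end symAlg

/-! ### Power sums -/

section powerSum

variable (R : Type*) [CommRing R]

/-- The power sum `x₁ᵇ + x₂ᵇ + ⋯`. -/
def powerSum (b : ℕ) : MvPowerSeries ℕ R :=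
  Set.indicator {m : ℕ →₀ ℕ | ∃ c ≠ 0, Finsupp.single c b = m} 1

variable {R}

open scoped Classical in
theorem coeff_powerSum (b : ℕ) (m : ℕ →₀ ℕ) :
    coeff m (powerSum R b) = if ∃ c ≠ 0, Finsupp.single c b = m then 1 else 0 := by
  rw [coeff_apply, powerSum, Set.indicator_apply]
  rfl

theorem isHomogeneous_powerSum (b : ℕ) : (powerSum R b).IsHomogeneous b := by
  classical
  refine isHomogeneous_iff_degree.2 fun m hm => ?_
  rw [coeff_powerSum, ite_ne_right_iff] at hm
  obtain ⟨⟨c, -, rfl⟩, -⟩ := hm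
  exact Finsupp.degree_single c b

theorem powerSum_mem_symAlg (b : ℕ) : powerSum R b ∈ symAlg R := by
  classical
  have himp {m n : ℕ →₀ ℕ} (h : shape m = shape n) :
      (∃ c ≠ 0, Finsupp.single c b = m) → ∃ c ≠ 0, Finsupp.single c b = n := by
    obtain ⟨π, hπ0, hπ⟩ := exists_perm_of_shape_eq h
    rintro ⟨c, hc, rfl⟩
    refine ⟨π c, fun h => hc (π.injective (h.trans hπ0.symm)), Finsupp.ext fun d => ?_⟩
    obtain ⟨d, rfl⟩ := π.surjective d
    simp [hπ, Finsupp.single_apply]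
  intro m n h
  rw [coeff_powerSum, coeff_powerSum]
  exact if_congr ⟨himp h, himp h.symm⟩ rfl rfl

theorem coeff_powerSum_mul {b : ℕ} (hb : b ≠ 0) (f : MvPowerSeries ℕ R) (m : ℕ →₀ ℕ) :
    coeff m (powerSum R b * f) =
      ∑ c ∈ posSupp m with b ≤ m c, coeff (m - Finsupp.single c b) f := by
  classical
  simp only [coeff_mul, coeff_powerSum, ite_mul, one_mul, zero_mul]
  rw [← sum_filter]
  symm
  refine sum_bij (fun c _ => (Finsupp.single c b, m - Finsupp.single c b)) ?_ ?_ ?_ fun _ _ => rfl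
  · intro c hc
    obtain ⟨hcm, hbc⟩ := mem_filter.1 hc
    refine mem_filter.2 ⟨mem_antidiagonal.2 ?_, c, (mem_posSupp.1 hcm).1, rfl⟩
    exact add_tsub_cancel_of_le (Finsupp.single_le_iff.2 hbc)
  · intro c _ d _ h
    exact (Finsupp.single_left_inj hb).1 (Prod.ext_iff.1 h).1
  · rintro ⟨_, n⟩ hp
    obtain ⟨hmn, c, hc, rfl⟩ := mem_filter.1 hp
    obtain rfl := mem_antidiagonal.1 hmn
    refine ⟨c, mem_filter.2 ⟨mem_posSupp.2 ⟨hc, ?_⟩, ?_⟩, ?_⟩ <;> simp [hb]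

theorem sum_card_filter_succ_le {m : ℕ →₀ ℕ} {n : ℕ} (hm : m.degree = n) (h0 : m 0 = 0) :
    ∑ i ∈ range n, #{c ∈ posSupp m | i + 1 ≤ m c} = n := by
  have hcount {c : ℕ} : #{i ∈ range n | i + 1 ≤ m c} = m c := by
    have hle : m c ≤ n := hm ▸ Finsupp.le_degree c m
    have hfilter : {i ∈ range n | i + 1 ≤ m c} = range (m c) := by
      ext i
      simp only [mem_filter, mem_range]
      omega
    rw [hfilter, card_range]
  calc ∑ i ∈ range n, #{c ∈ posSupp m | i + 1 ≤ m c}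
      = ∑ c ∈ posSupp m, #{i ∈ range n | i + 1 ≤ m c} :=
        sum_card_bipartiteAbove_eq_sum_card_bipartiteBelow fun i c => i + 1 ≤ m c
    _ = n := by
        rw [sum_congr rfl fun c _ => hcount, ← hm, ← size_shape, PseudoComp.size, shape_head, h0,
          zero_add, ← Multiset.sum_coe, coe_shape_tail, posValues, sum_map_val]

theorem succ_nsmul_hPos (n : ℕ) :
    (n + 1) • hPos R (n + 1) = ∑ i ∈ range (n + 1), powerSum R (i + 1) * hPos R (n - i) := by
  classical
  ext m
  have hterm {i c : ℕ} (hi : i ∈ range (n + 1)) (hc : c ∈ posSupp m) (hic : i + 1 ≤ m c) :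
      coeff (m - Finsupp.single c (i + 1)) (hPos R (n - i)) = coeff m (hPos R (n + 1)) := by
    have hadd := add_tsub_cancel_of_le (Finsupp.single_le_iff.2 hic)
    have hdeg := congrArg Finsupp.degree hadd
    rw [map_add, Finsupp.degree_single] at hdeg
    have h0 : (m - Finsupp.single c (i + 1)) 0 = m 0 := by simp [(mem_posSupp.1 hc).1]
    have hin := mem_range.1 hi
    rw [coeff_hPos, coeff_hPos, h0]
    exact if_congr (and_congr_left' (by omega)) rfl rfl
  have hcoeff {i : ℕ} (hi : i ∈ range (n + 1)) :
      coeff m (powerSum R (i + 1) * hPos R (n - i)) =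
        #{c ∈ posSupp m | i + 1 ≤ m c} • coeff m (hPos R (n + 1)) := by
    rw [coeff_powerSum_mul i.succ_ne_zero, ← sum_const]
    exact sum_congr rfl fun c hc => hterm hi (mem_filter.1 hc).1 (mem_filter.1 hc).2
  rw [map_nsmul, map_sum, sum_congr rfl fun i => hcoeff, ← sum_smul, coeff_hPos]
  split_ifs with hm
  · rw [sum_card_filter_succ_le hm.1 hm.2]
  · rw [smul_zero, smul_zero]

theorem powerSum_mem_adjoin (n : ℕ) :
    powerSum R (n + 1) ∈ Algebra.adjoin R (Set.range (hPos R)) := by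
  induction n using Nat.strong_induction_on with
  | _ n ih =>
    have hsub (k : ℕ) : hPos R k ∈ Algebra.adjoin R (Set.range (hPos R)) :=
      Algebra.subset_adjoin ⟨k, rfl⟩
    have hnewton := succ_nsmul_hPos (R := R) n
    rw [sum_range_succ, Nat.sub_self, hPos_zero, mul_one] at hnewton
    rw [← sub_eq_iff_eq_add'.2 hnewton]
    refine sub_mem (nsmul_mem (hsub _) _) (sum_mem fun i hi => mul_mem (ih i ?_) (hsub _))
    exact mem_range.1 hi

end powerSum

/-! ### Monomial series as polynomials in `x₀` and the power sums -/

section monomial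

theorem posValues_eq_cons_sub_single {m : ℕ →₀ ℕ} {c : ℕ} (hc : c ∈ posSupp m) :
    posValues m = m c ::ₘ posValues (m - Finsupp.single c (m c)) := by
  obtain ⟨hc0, hmc⟩ := mem_posSupp.1 hc
  nth_rw 1 [← tsub_add_cancel_of_le (Finsupp.single_le_iff.2 le_rfl : Finsupp.single c (m c) ≤ m)]
  exact posValues_add_single hc0 hmc (by simp)

theorem card_posValues_sub_single {m : ℕ →₀ ℕ} {b c : ℕ} (hb : b < m c) :
    (posValues (m - Finsupp.single c b)).card = (posValues m).card := by
  have hmc : (m - Finsupp.single c b) c ≠ 0 := by simpa using (Nat.sub_pos_of_lt hb).ne'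
  rw [← card_posValues_add_single hmc b, tsub_add_cancel_of_le (Finsupp.single_le_iff.2 hb.le)]

variable {R : Type*} [CommRing R]

theorem mOver_of_tail_eq_nil {l : PseudoPart} (hl : l.1.tail = []) :
    mOver R l = X 0 ^ l.1.head := by
  classical
  have hshape (m : ℕ →₀ ℕ) : shape m = l ↔ m = Finsupp.single 0 l.1.head := by
    rw [shape_eq_iff, hl, Multiset.coe_nil, posValues, Multiset.map_eq_zero, val_eq_zero]
    constructor
    · rintro ⟨h0, hsupp⟩
      ext c
      by_cases hc : c = 0
      · rw [hc, h0, Finsupp.single_eq_same]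
      · have hmc : c ∉ posSupp m := by rw [hsupp]; exact notMem_empty c
        rw [Finsupp.single_eq_of_ne hc]
        exact by_contra fun h => hmc (mem_posSupp.2 ⟨hc, h⟩)
    · rintro rfl
      refine ⟨Finsupp.single_eq_same, eq_empty_of_forall_notMem fun c hc => ?_⟩
      obtain ⟨hc0, hc⟩ := mem_posSupp.1 hc
      exact hc (Finsupp.single_eq_of_ne hc0)
  ext m
  simp only [coeff_mOver, coeff_X_pow, hshape]

theorem shape_sub_single_eq_iff {k l : PseudoPart} {m : ℕ →₀ ℕ} {c : ℕ} (hc : c ∈ posSupp m)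
    (hhead : k.1.head = l.1.head) (htail : l.1.tail = m c :: k.1.tail) :
    shape (m - Finsupp.single c (m c)) = k ↔ shape m = l := by
  have h0 : (m - Finsupp.single c (m c)) 0 = m 0 := by simp [(mem_posSupp.1 hc).1]
  rw [shape_eq_iff, shape_eq_iff, h0, hhead, posValues_eq_cons_sub_single hc, htail,
    ← Multiset.cons_coe, Multiset.cons_inj_right]

theorem length_tail_shape_sub_single {m : ℕ →₀ ℕ} {b c : ℕ} (hb : b < m c) :
    (shape (m - Finsupp.single c b)).1.tail.length = (shape m).1.tail.length := by
  rw [← Multiset.coe_card, ← Multiset.coe_card, coe_shape_tail, coe_shape_tail,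
    card_posValues_sub_single hb]

theorem coeff_powerSum_mul_mOver {k l : PseudoPart} {b : ℕ} (hhead : k.1.head = l.1.head)
    (htail : l.1.tail = b :: k.1.tail) {m : ℕ →₀ ℕ} (hm : shape m = l) :
    coeff m (powerSum R b * mOver R k) = (l.1.tail.count b : R) := by
  classical
  have hb : b ≠ 0 := (l.1.tail_pos b (by simp [htail])).ne'
  have hiff {c : ℕ} (hc : c ∈ posSupp m) (hbc : b ≤ m c) :
      shape (m - Finsupp.single c b) = k ↔ b = m c := by
    constructor
    · intro h
      by_contra hne
      have hlen := length_tail_shape_sub_single (lt_of_le_of_ne hbc hne)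
      simp [h, hm, htail] at hlen
    · rintro rfl
      exact (shape_sub_single_eq_iff hc hhead htail).2 hm
  have hsum : coeff m (powerSum R b * mOver R k) = #{c ∈ posSupp m | b = m c} := by
    rw [coeff_powerSum_mul hb, sum_congr rfl fun c _ => coeff_mOver R k _, sum_boole, filter_filter]
    congr 2
    ext c
    simp only [mem_filter]
    exact and_congr_right fun hc =>
      ⟨fun h => (hiff hc h.1).1 h.2, fun h => ⟨h.le, (hiff hc h.le).2 h⟩⟩
  rw [hsum, ← Multiset.coe_count, ← ((shape_eq_iff m l).1 hm).2, posValues, Multiset.count_map]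
  rfl

theorem length_tail_shape_lt {k l : PseudoPart} {b : ℕ} (hhead : k.1.head = l.1.head)
    (htail : l.1.tail = b :: k.1.tail) {m : ℕ →₀ ℕ} (hm : shape m ≠ l)
    (hcoeff : coeff m (powerSum R b * mOver R k) ≠ 0) :
    (shape m).1.tail.length < l.1.tail.length := by
  classical
  have hb : b ≠ 0 := (l.1.tail_pos b (by simp [htail])).ne'
  rw [coeff_powerSum_mul hb] at hcoeff
  obtain ⟨c, hc, hne⟩ := exists_ne_zero_of_sum_ne_zero hcoeff
  obtain ⟨hcm, hbc⟩ := mem_filter.1 hc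
  rw [coeff_mOver, ite_ne_right_iff] at hne
  obtain rfl | hlt := hbc.eq_or_lt
  · exact absurd ((shape_sub_single_eq_iff hcm hhead htail).1 hne.1) hm
  · rw [← length_tail_shape_sub_single hlt, hne.1, htail]
    exact Nat.lt_succ_self _

theorem mOver_mem_adjoin_powerSum [Algebra ℚ R] (l : PseudoPart) :
    mOver R l ∈ Algebra.adjoin R (insert (X 0) (Set.range fun n => powerSum R (n + 1))) := by
  classical
  set S := Algebra.adjoin R (insert (X 0) (Set.range fun n => powerSum R (n + 1)))
  induction hlen : l.1.tail.length using Nat.strong_induction_on generalizing l with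
  | _ N ih =>
    rcases htail : l.1.tail with - | ⟨b, t⟩
    · rw [mOver_of_tail_eq_nil htail]
      exact pow_mem (Algebra.subset_adjoin (Set.mem_insert _ _)) _
    let k : PseudoPart := ⟨⟨l.1.head, t, fun a ha => l.1.tail_pos a (by simp [htail, ha])⟩,
      (List.pairwise_cons.1 (htail ▸ l.2)).2⟩
    have hb : 0 < b := l.1.tail_pos b (by simp [htail])
    have hpS : powerSum R b ∈ S :=
      Algebra.subset_adjoin (Or.inr ⟨b - 1, by simp only [Nat.sub_add_cancel hb]⟩)
    have hkS : mOver R k ∈ S := ih _ (by simp [← hlen, htail, k]) k rfl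
    have hsize : b + k.1.size = l.1.size := by
      simp only [PseudoComp.size, htail, k, List.sum_cons]
      omega
    have hhom : (powerSum R b * mOver R k).IsHomogeneous l.1.size :=
      hsize ▸ IsHomogeneous.mul (isHomogeneous_powerSum b) (isHomogeneous_mOver k)
    have hexpand := eq_sum_mOver (mul_mem (powerSum_mem_symAlg b) (mOver_mem_symAlg k)) hhom
    rw [← sum_erase_add _ _ (a := l) (by simp),
      coeff_powerSum_mul_mOver (k := k) (l := l) rfl htail (shape_monomialOf l)] at hexpand
    have hcount : IsUnit (l.1.tail.count b : R) := by
      have hne : (l.1.tail.count b : ℚ) ≠ 0 := by simp [htail, Nat.cast_add_one_ne_zero]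
      simpa using (IsUnit.mk0 _ hne).map (algebraMap ℚ R)
    refine ((Subalgebra.toSubmodule S).smul_mem_iff_of_isUnit hcount).1 ?_
    rw [← sub_eq_iff_eq_add'.2 hexpand]
    refine sub_mem (S.mul_mem hpS hkS) (sum_mem fun j hj => ?_)
    rcases eq_or_ne (coeff (monomialOf j) (powerSum R b * mOver R k)) 0 with hzero | hne
    · simp [hzero]
    · have hlt := length_tail_shape_lt (k := k) (l := l) rfl htail
        (by rw [shape_monomialOf]; exact (mem_erase.1 hj).1) hne
      rw [shape_monomialOf, hlen] at hlt
      exact S.smul_mem (ih _ hlt j rfl) _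

end monomial

/-! ### Square roots of generating series -/

section squareRoot

theorem coeff_mem_of_coeff_sq_mem {R B : Type*} [CommRing R] [CommRing B] [Algebra R B]
    [Algebra ℚ R] (A : Subalgebra R B) {f : PowerSeries B} (h0 : PowerSeries.constantCoeff f = 1)
    (hsq : ∀ n, PowerSeries.coeff n (f ^ 2) ∈ A) (n : ℕ) : PowerSeries.coeff n f ∈ A := by
  induction n using Nat.strong_induction_on with
  | _ n ih =>
    have hone (k : ℕ) : PowerSeries.coeff k (1 : PowerSeries B) ∈ A := by
      rw [PowerSeries.coeff_one]
      split_ifs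
      exacts [A.one_mem, A.zero_mem]
    have hlower (p : ℕ × ℕ) (hp : p ∈ antidiagonal n) :
        PowerSeries.coeff p.1 (f - 1) * PowerSeries.coeff p.2 (f - 1) ∈ A := by
      have hzero : PowerSeries.coeff 0 (f - 1) = 0 := by simp [h0]
      rw [mem_antidiagonal] at hp
      rcases Nat.eq_zero_or_pos p.1 with h1 | h1
      · simp only [h1, hzero, zero_mul, zero_mem]
      rcases Nat.eq_zero_or_pos p.2 with h2 | h2
      · simp only [h2, hzero, mul_zero, zero_mem]
      simp only [map_sub]
      exact mul_mem (sub_mem (ih _ (by omega)) (hone _)) (sub_mem (ih _ (by omega)) (hone _))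
    have htwo : IsUnit (2 : R) := by
      simpa only [map_ofNat] using (IsUnit.mk0 (2 : ℚ) two_ne_zero).map (algebraMap ℚ R)
    refine ((Subalgebra.toSubmodule A).smul_mem_iff_of_isUnit htwo).1 ?_
    have hexpand : (2 : R) • PowerSeries.coeff n f = PowerSeries.coeff n (f ^ 2) +
        PowerSeries.coeff n 1 - PowerSeries.coeff n ((f - 1) * (f - 1)) := by
      rw [← map_add, ← map_sub, show f ^ 2 + 1 - (f - 1) * (f - 1) = f + f by ring, map_add,
        two_smul]
    rw [hexpand, PowerSeries.coeff_mul]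
    exact sub_mem (add_mem (hsq n) (hone n)) (sum_mem hlower)

/-- The series `(1 - a t) ^ s` in `t`. -/
def binomialPow {B : Type*} [CommRing B] [Algebra ℚ B] (a : B) (s : ℚ) : PowerSeries B :=
  PowerSeries.rescale (-a) (PowerSeries.binomialSeries B s)

variable {B : Type*} [CommRing B] [Algebra ℚ B] (a : B)

theorem coeff_binomialPow (s : ℚ) (n : ℕ) :
    PowerSeries.coeff n (binomialPow a s) = ((-1) ^ n * Ring.choose s n) • a ^ n := by
  rw [binomialPow, PowerSeries.coeff_rescale, PowerSeries.binomialSeries_coeff, neg_pow,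
    mul_smul_comm, mul_one, mul_comm ((-1 : ℚ) ^ n), mul_smul]
  simp [Algebra.smul_def]

theorem binomialPow_add (s t : ℚ) :
    binomialPow a (s + t) = binomialPow a s * binomialPow a t := by
  rw [binomialPow, PowerSeries.binomialSeries_add, map_mul, binomialPow, binomialPow]

theorem binomialPow_zero : binomialPow a 0 = 1 := by
  rw [binomialPow, PowerSeries.binomialSeries_zero, map_one]

theorem binomialPow_one : binomialPow a 1 = 1 - PowerSeries.C a * PowerSeries.X := by
  rw [binomialPow, show (1 : ℚ) = (1 : ℕ) by simp, PowerSeries.binomialSeries_nat, pow_one,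
    map_add, map_one, PowerSeries.rescale_X, map_neg, neg_mul, sub_eq_add_neg]

theorem choose_neg_half_ne_zero (n : ℕ) : Ring.choose (-(1 / 2) : ℚ) n ≠ 0 := by
  have hpos : 0 < n.factorial • Ring.multichoose (1 / 2 : ℚ) n := by
    rw [Ring.factorial_nsmul_multichoose_eq_ascPochhammer, Polynomial.ascPochhammer_smeval_eq_eval]
    exact ascPochhammer_pos n _ (by norm_num)
  rw [Ring.choose_neg', Units.smul_def, smul_ne_zero_iff]
  exact ⟨Units.ne_zero _, right_ne_zero_of_smul hpos.ne'⟩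

end squareRoot

section typeB

variable {R : Type*} [CommRing R]

theorem hAll_zero : hAll R 0 = 1 := by
  rw [hAll_eq_sum, antidiagonal_zero, sum_singleton, pow_zero, one_mul, hPos_zero]

theorem hDbl_zero : hDbl R 0 = 1 := by
  rw [hDbl, antidiagonal_zero, sum_singleton, hPos_zero, hAll_zero, one_mul]

theorem mul_mem_span_hBOver {f g : MvPowerSeries ℕ R}
    (hf : f ∈ Submodule.span R (Set.range (hBOver R)))
    (hg : g ∈ Algebra.adjoin R (Set.range (hDbl R))) :
    f * g ∈ Submodule.span R (Set.range (hBOver R)) := by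
  induction hg using Algebra.adjoin_induction generalizing f with
  | mem g hg =>
    obtain ⟨k, rfl⟩ := hg
    induction hf using Submodule.span_induction with
    | mem f hf =>
      obtain ⟨α, rfl⟩ := hf
      rcases Nat.eq_zero_or_pos k with rfl | hk
      · rw [hDbl_zero, mul_one]
        exact Submodule.subset_span ⟨α, rfl⟩
      · exact Submodule.subset_span ⟨α.snoc k hk, hBOver_snoc α k hk⟩
    | zero => rw [zero_mul]; exact Submodule.zero_mem _
    | add f₁ f₂ _ _ h₁ h₂ => rw [add_mul]; exact Submodule.add_mem _ h₁ h₂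
    | smul c f _ h => rw [smul_mul_assoc]; exact Submodule.smul_mem _ c h
  | algebraMap c =>
    rw [mul_comm, ← Algebra.smul_def]
    exact Submodule.smul_mem _ c hf
  | add g₁ g₂ _ _ h₁ h₂ => rw [mul_add]; exact Submodule.add_mem _ (h₁ hf) (h₂ hf)
  | mul g₁ g₂ _ _ h₁ h₂ => rw [← mul_assoc]; exact h₂ (h₁ hf)

theorem hBOver_mem_adjoin_hPos (α : PseudoComp) :
    hBOver R α ∈ Algebra.adjoin R (insert (X 0) (Set.range (hPos R))) := by
  set S := Algebra.adjoin R (insert (X 0) (Set.range (hPos R)))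
  have hpos (k : ℕ) : hPos R k ∈ S := Algebra.subset_adjoin (Or.inr ⟨k, rfl⟩)
  have hX : X 0 ∈ S := Algebra.subset_adjoin (Or.inl rfl)
  have hall (k : ℕ) : hAll R k ∈ S := by
    rw [hAll_eq_sum]
    exact sum_mem fun p _ => mul_mem (pow_mem hX _) (hpos _)
  refine mul_mem (hall _) (list_prod_mem ?_)
  rintro f hf
  obtain ⟨k, -, rfl⟩ := List.mem_map.1 hf
  exact sum_mem fun p _ => mul_mem (hpos _) (hall _)

variable (R)

theorem mk_hDbl :
    PowerSeries.mk (hDbl R) = PowerSeries.mk (hPos R) * PowerSeries.mk (hAll R) := by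
  ext1 n
  simp only [PowerSeries.coeff_mul, PowerSeries.coeff_mk, hDbl]

theorem mk_hPos [Algebra ℚ R] :
    PowerSeries.mk (hPos R) = PowerSeries.mk (hAll R) * binomialPow (X 0) 1 := by
  have hmul : PowerSeries.mk (hAll R) =
      PowerSeries.mk (fun n => (X 0 : MvPowerSeries ℕ R) ^ n) * PowerSeries.mk (hPos R) := by
    ext1 n
    simp only [PowerSeries.coeff_mul, PowerSeries.coeff_mk, hAll_eq_sum]
  have hgeom : PowerSeries.mk (fun n => (X 0 : MvPowerSeries ℕ R) ^ n) *
      binomialPow (X 0) 1 = 1 := by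
    have h := congrArg (PowerSeries.rescale (X 0 : MvPowerSeries ℕ R))
      (PowerSeries.mk_one_mul_one_sub_eq_one (MvPowerSeries ℕ R))
    rw [map_mul, map_sub, map_one, PowerSeries.rescale_X, PowerSeries.rescale_mk] at h
    simpa only [binomialPow_one, Pi.one_apply, mul_one] using h
  rw [hmul, mul_right_comm, hgeom, one_mul]

variable [Algebra ℚ R]

/-- The series `√(∑ hPos_k t^k · ∑ hAll_k t^k)` in `t`, the square root with constant term `1` of
the generating series of the `hDbl_k`. -/
def sqrtSeries : PowerSeries (MvPowerSeries ℕ R) :=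
  PowerSeries.mk (hAll R) * binomialPow (X 0) (1 / 2)

theorem sqrtSeries_sq : sqrtSeries R ^ 2 = PowerSeries.mk (hDbl R) := by
  rw [mk_hDbl, mk_hPos, show (1 : ℚ) = 1 / 2 + 1 / 2 by norm_num, binomialPow_add, sqrtSeries]
  ring

theorem constantCoeff_sqrtSeries : PowerSeries.constantCoeff (sqrtSeries R) = 1 := by
  rw [sqrtSeries, map_mul, PowerSeries.constantCoeff_mk, hAll_zero, one_mul,
    ← PowerSeries.coeff_zero_eq_constantCoeff_apply, coeff_binomialPow]
  simp

variable {R}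

theorem coeff_sqrtSeries_mem (n : ℕ) :
    PowerSeries.coeff n (sqrtSeries R) ∈ Algebra.adjoin R (Set.range (hDbl R)) := by
  refine coeff_mem_of_coeff_sq_mem _ (constantCoeff_sqrtSeries R) (fun k => ?_) n
  rw [sqrtSeries_sq, PowerSeries.coeff_mk]
  exact Algebra.subset_adjoin ⟨k, rfl⟩

theorem mk_hPos_eq_sqrtSeries_mul :
    PowerSeries.mk (hPos R) = sqrtSeries R * binomialPow (X 0) (1 / 2) := by
  rw [mk_hPos, sqrtSeries, mul_assoc, ← binomialPow_add]
  norm_num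

theorem mk_hAll_eq_sqrtSeries_mul :
    PowerSeries.mk (hAll R) = sqrtSeries R * binomialPow (X 0) (-(1 / 2)) := by
  rw [sqrtSeries, mul_assoc, ← binomialPow_add, add_neg_cancel, binomialPow_zero, mul_one]

theorem hPos_mem_adjoin_hDbl (n : ℕ) :
    hPos R n ∈ Algebra.adjoin R (insert (X 0) (Set.range (hDbl R))) := by
  rw [← PowerSeries.coeff_mk n (hPos R), mk_hPos_eq_sqrtSeries_mul, PowerSeries.coeff_mul]
  refine sum_mem fun p _ => mul_mem
    (Algebra.adjoin_mono (Set.subset_insert _ _) (coeff_sqrtSeries_mem p.1)) ?_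
  rw [coeff_binomialPow, ← algebraMap_smul R]
  exact Subalgebra.smul_mem _ (pow_mem (Algebra.subset_adjoin (Set.mem_insert _ _)) _) _

theorem X_pow_mem_span_hBOver (n : ℕ) :
    (X 0 : MvPowerSeries ℕ R) ^ n ∈ Submodule.span R (Set.range (hBOver R)) := by
  induction n using Nat.strong_induction_on with
  | _ n ih =>
    set c : ℕ → ℚ := fun k => (-1) ^ k * Ring.choose (-(1 / 2) : ℚ) k
    have hc : IsUnit (algebraMap ℚ R (c n)) :=
      (IsUnit.mk0 (c n) (mul_ne_zero (pow_ne_zero n (by norm_num))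
        (choose_neg_half_ne_zero n))).map _
    have hexpand : hAll R n = ∑ p ∈ antidiagonal n,
        PowerSeries.coeff p.1 (sqrtSeries R) * algebraMap ℚ R (c p.2) • X 0 ^ p.2 := by
      rw [← PowerSeries.coeff_mk n (hAll R), mk_hAll_eq_sqrtSeries_mul, PowerSeries.coeff_mul]
      simp only [coeff_binomialPow, algebraMap_smul, c]
    rw [← add_sum_erase _ _ (a := (0, n)) (by simp),
      PowerSeries.coeff_zero_eq_constantCoeff_apply, constantCoeff_sqrtSeries, one_mul] at hexpand
    refine ((Submodule.span R _).smul_mem_iff_of_isUnit hc).1 ?_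
    rw [← sub_eq_iff_eq_add.2 hexpand]
    refine sub_mem (Submodule.subset_span ⟨.single n, hBOver_single n⟩) (sum_mem fun p hp => ?_)
    have hlt : p.2 < n := by
      obtain ⟨hne, hsum⟩ := mem_erase.1 hp
      rw [mem_antidiagonal] at hsum
      rw [Ne, Prod.ext_iff] at hne
      omega
    rw [mul_comm]
    exact mul_mem_span_hBOver (Submodule.smul_mem _ _ (ih _ hlt)) (coeff_sqrtSeries_mem _)

theorem adjoin_insert_hDbl_le :
    Subalgebra.toSubmodule (Algebra.adjoin R (insert (X 0) (Set.range (hDbl R)))) ≤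
      Submodule.span R (Set.range (hBOver R)) := by
  rw [← Set.singleton_union, Algebra.adjoin_union_coe_submodule, Submodule.mul_le]
  intro f hf g hg
  refine mul_mem_span_hBOver ?_ hg
  rw [Algebra.adjoin_eq_span, ← Submonoid.powers_eq_closure] at hf
  refine Submodule.span_le.2 ?_ hf
  rintro _ ⟨n, rfl⟩
  exact X_pow_mem_span_hBOver n

theorem adjoin_insert_hPos_eq :
    Subalgebra.toSubmodule (Algebra.adjoin R (insert (X 0) (Set.range (hPos R)))) =
      Submodule.span R (Set.range (hBOver R)) := by
  refine le_antisymm (le_trans ?_ adjoin_insert_hDbl_le) (Submodule.span_le.2 ?_)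
  · refine Algebra.adjoin_le (Set.insert_subset (Algebra.subset_adjoin (Or.inl rfl)) ?_)
    rintro _ ⟨k, rfl⟩
    exact hPos_mem_adjoin_hDbl k
  · rintro _ ⟨α, rfl⟩
    exact hBOver_mem_adjoin_hPos α

theorem span_mOver_eq :
    Submodule.span R (Set.range (mOver R)) = Submodule.span R (Set.range (hBOver R)) := by
  refine le_antisymm (Submodule.span_le.2 ?_) (Submodule.span_le.2 ?_)
  · rintro _ ⟨l, rfl⟩
    rw [← adjoin_insert_hPos_eq]
    refine Algebra.adjoin_le (Set.insert_subset ?_ ?_) (mOver_mem_adjoin_powerSum l)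
    · exact Algebra.subset_adjoin (Or.inl rfl)
    · rintro _ ⟨n, rfl⟩
      exact Algebra.adjoin_mono (Set.subset_insert _ _) (powerSum_mem_adjoin n)
  · rintro _ ⟨α, rfl⟩
    exact Submodule.span_mono (Set.image_subset_range _ _) (hBOver_mem_span_mOver α)

end typeB

/-! ### The pseudo-partition bases -/

section graded

variable {ι R M : Type*} [CommRing R] [AddCommGroup M] [Module R M]

theorem injective_of_surjective_of_comp_eq {κ : Type*} {T : M →ₗ[R] M}
    (hT : Function.Surjective T) {π : κ → M →ₗ[R] M} (hcomm : ∀ n, π n ∘ₗ T = T ∘ₗ π n)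
    (hfg : ∀ n, (LinearMap.range (π n)).FG)
    (hsep : ∀ x, (∀ n, π n x = 0) → x = 0) : Function.Injective T := by
  rw [injective_iff_map_eq_zero]
  refine fun x hx => hsep x fun n => ?_
  have := Module.Finite.of_fg (hfg n)
  have hmap : ∀ y ∈ LinearMap.range (π n), T y ∈ LinearMap.range (π n) := by
    rintro _ ⟨y, rfl⟩
    exact ⟨T y, LinearMap.congr_fun (hcomm n) y⟩
  have hsurj : Function.Surjective (T.restrict hmap) := by
    rintro ⟨_, y, rfl⟩
    obtain ⟨z, rfl⟩ := hT y
    exact ⟨⟨π n z, z, rfl⟩, Subtype.ext (LinearMap.congr_fun (hcomm n) z).symm⟩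
  have hinj := OrzechProperty.injective_of_surjective_endomorphism _ hsurj
  have hzero : (⟨π n x, x, rfl⟩ : LinearMap.range (π n)) = 0 := hinj <| Subtype.ext <| by
    rw [map_zero]
    exact (LinearMap.congr_fun (hcomm n) x).symm.trans (by simp [hx])
  exact congrArg Subtype.val hzero

/-- The projection of a module with a basis indexed by a graded set onto its `n`-th graded piece. -/
def gradedProj (b : Module.Basis ι R M) (w : ι → ℕ) (n : ℕ) : M →ₗ[R] M :=
  b.constr R fun i => if w i = n then b i else 0

theorem gradedProj_basis (b : Module.Basis ι R M) (w : ι → ℕ) (n : ℕ) (i : ι) :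
    gradedProj b w n (b i) = if w i = n then b i else 0 :=
  b.constr_basis _ _ _

theorem gradedProj_of_mem_span (b : Module.Basis ι R M) {w : ι → ℕ} {m : ℕ} (n : ℕ) {x : M}
    (hx : x ∈ Submodule.span R (b '' {i | w i = m})) :
    gradedProj b w n x = if m = n then x else 0 := by
  induction hx using Submodule.span_induction with
  | mem x hx => obtain ⟨i, rfl, rfl⟩ := hx; exact gradedProj_basis b w n i
  | zero => rw [map_zero, ite_self]
  | add x y _ _ hx hy => rw [map_add, hx, hy]; split_ifs <;> simp only [add_zero]
  | smul c x _ hx => rw [map_smul, hx, smul_ite, smul_zero]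

theorem range_gradedProj (b : Module.Basis ι R M) (w : ι → ℕ) (n : ℕ) :
    LinearMap.range (gradedProj b w n) = Submodule.span R (b '' {i | w i = n}) := by
  refine le_antisymm ?_ fun x hx => ⟨x, (gradedProj_of_mem_span b n hx).trans (if_pos rfl)⟩
  rw [LinearMap.range_eq_map, ← b.span_eq, Submodule.map_span, Submodule.span_le]
  rintro _ ⟨_, ⟨i, rfl⟩, rfl⟩
  rw [gradedProj_basis]
  split_ifs with h
  exacts [Submodule.subset_span ⟨i, h, rfl⟩, Submodule.zero_mem _]

theorem linearIndependent_of_graded (b : Module.Basis ι R M) {w : ι → ℕ}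
    (hw : ∀ n, {i | w i = n}.Finite) {v : ι → M}
    (hv : ∀ i, v i ∈ Submodule.span R (b '' {j | w j = w i}))
    (hspan : ⊤ ≤ Submodule.span R (Set.range v)) : LinearIndependent R v := by
  have hT (i : ι) : b.constr R v (b i) = v i := b.constr_basis _ _ _
  have hinj : Function.Injective (b.constr R v) := by
    refine injective_of_surjective_of_comp_eq (π := gradedProj b w) ?_ (fun n => ?_)
      (fun n => ?_) fun x hx => ?_
    · rwa [← LinearMap.range_eq_top, Module.Basis.constr_range, eq_top_iff]
    · refine b.ext fun i => ?_
      simp only [LinearMap.comp_apply, hT, gradedProj_basis, gradedProj_of_mem_span b n (hv i),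
        apply_ite (b.constr R v), map_zero]
    · rw [range_gradedProj]
      exact Submodule.fg_span ((hw n).image b)
    · have hcoord (i : ι) : b.coord i ∘ₗ gradedProj b w (w i) = b.coord i := by
        refine b.ext fun j => ?_
        rw [LinearMap.comp_apply, gradedProj_basis]
        split_ifs with hj
        · rfl
        · rw [map_zero, b.coord_apply, b.repr_self, Finsupp.single_eq_of_ne (by grind)]
      refine b.ext_elem fun i => ?_
      rw [map_zero, ← b.coord_apply, ← hcoord i, LinearMap.comp_apply, hx, map_zero]
      rfl
  have := b.linearIndependent.map' _ (LinearMap.ker_eq_bot.2 hinj)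
  rwa [show b.constr R v ∘ b = v from funext hT] at this

end graded

section bases

theorem range_hBOver_part (R : Type*) [CommRing R] :
    (Set.range fun l : PseudoPart => hBOver R l.1) = Set.range (hBOver R) := by
  refine Set.Subset.antisymm (Set.range_subset_iff.2 fun l => ⟨l.1, rfl⟩) ?_
  rintro _ ⟨α, rfl⟩
  exact ⟨α.toPart, hBOver_toPart R α⟩

theorem linearIndependent_hBOver_of_rat (R : Type*) [CommRing R] [Algebra ℚ R] :
    LinearIndependent R fun l : PseudoPart => hBOver R l.1 := by
  set W := Submodule.span R (Set.range (mOver R))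
  let b : Module.Basis PseudoPart R W := Module.Basis.span linearIndependent_mOver
  have hb : W.subtype ∘ b = mOver R :=
    funext fun l => congrArg W.subtype (Module.Basis.span_apply _ l)
  let v (l : PseudoPart) : W := ⟨hBOver R l.1,
    Submodule.span_mono (Set.image_subset_range _ _) (hBOver_mem_span_mOver l.1)⟩
  suffices h : LinearIndependent R v from h.map' W.subtype W.ker_subtype
  refine linearIndependent_of_graded b finite_setOf_partSize_eq (fun l => ?_) ?_
  · rw [← Submodule.comap_map_eq_of_injective W.subtype_injective (Submodule.span R _),
      Submodule.map_span, ← Set.image_comp, hb]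
    exact hBOver_mem_span_mOver l.1
  · rw [← Submodule.map_le_map_iff_of_injective W.subtype_injective, Submodule.map_span,
      ← Set.range_comp, Submodule.map_top, Submodule.range_subtype]
    exact (span_mOver_eq.trans (congrArg _ (range_hBOver_part R).symm)).le

theorem linearIndependent_hBOver_int : LinearIndependent ℤ fun l : PseudoPart => hBOver ℤ l.1 := by
  refine .of_comp (MvPowerSeries.map (Int.castRingHom ℚ)).toAddMonoidHom.toIntLinearMap ?_
  have h := (linearIndependent_hBOver_of_rat ℚ).restrict_scalars' ℤ
  simp only [← map_hBOver ℚ] at h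
  exact h

/-- The `ℤ`-basis of `Symᴮ` consisting of the `hᴮ_λ`. -/
def hBasisInt : Module.Basis PseudoPart ℤ SymB :=
  (Module.Basis.span linearIndependent_hBOver_int).map
    (LinearEquiv.ofEq _ _ (by rw [range_hBOver_part, symB_eq_span]))

theorem coe_hBasisInt (l : PseudoPart) : (hBasisInt l : MvPowerSeries ℕ ℤ) = hBOver ℤ l.1 := by
  rw [hBasisInt, Module.Basis.map_apply, LinearEquiv.coe_ofEq_apply, Module.Basis.span_apply]

end bases

/-! ### Extension of scalars and multiplication by polynomials in `x₀` -/

section scalars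

variable (R : Type*) [CommRing R]

theorem scalarExt_tmul (U : Submodule ℤ (MvPowerSeries ℕ ℤ)) (c : R) (f : U) :
    scalarExt R U (c ⊗ₜ f) = c • MvPowerSeries.map (Int.castRingHom R) f.1 := rfl

theorem extended_span (s : Set (MvPowerSeries ℕ ℤ)) :
    extended R (Submodule.span ℤ s) =
      Submodule.span R (MvPowerSeries.map (Int.castRingHom R) '' s) := by
  refine le_antisymm ?_ (Submodule.span_le.2 ?_)
  · rintro _ ⟨t, rfl⟩
    induction t with
    | zero => rw [map_zero]; exact Submodule.zero_mem _
    | add x y hx hy => rw [map_add]; exact Submodule.add_mem _ hx hy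
    | tmul c f =>
      obtain ⟨f, hf⟩ := f
      rw [scalarExt_tmul]
      refine Submodule.smul_mem _ c ?_
      induction hf using Submodule.span_induction with
      | mem x hx => exact Submodule.subset_span ⟨x, hx, rfl⟩
      | zero => rw [map_zero]; exact Submodule.zero_mem _
      | add x y _ _ hx hy => rw [map_add]; exact Submodule.add_mem _ hx hy
      | smul n x _ hx => rw [map_zsmul]; exact zsmul_mem hx n
  · rintro _ ⟨f, hf, rfl⟩
    exact ⟨1 ⊗ₜ ⟨f, Submodule.subset_span hf⟩, by rw [scalarExt_tmul, one_smul]⟩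

theorem toSubmodule_adjoin_hPos :
    Subalgebra.toSubmodule (Algebra.adjoin R (Set.range (hPos R))) =
      Submodule.span R (Set.range fun α : Comp => (α.1.map (hPos R)).prod) := by
  rw [Algebra.adjoin_eq_span]
  congr 1
  refine Set.Subset.antisymm (fun f hf => ?_) ?_
  · induction hf using Submonoid.closure_induction with
    | mem f hf =>
      obtain ⟨k, rfl⟩ := hf
      rcases Nat.eq_zero_or_pos k with rfl | hk
      · exact ⟨⟨[], by simp⟩, by simp [hPos_zero]⟩
      · exact ⟨⟨[k], by simpa using hk⟩, by simp⟩
    | one => exact ⟨⟨[], by simp⟩, by simp⟩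
    | mul f g _ _ hf hg =>
      obtain ⟨α, rfl⟩ := hf
      obtain ⟨β, rfl⟩ := hg
      exact ⟨⟨α.1 ++ β.1, fun a ha => (List.mem_append.1 ha).elim (α.2 a) (β.2 a)⟩, by simp⟩
  · rintro _ ⟨α, rfl⟩
    refine Submonoid.list_prod_mem _ fun f hf => ?_
    obtain ⟨k, -, rfl⟩ := List.mem_map.1 hf
    exact Submonoid.subset_closure ⟨k, rfl⟩

theorem symF_eq_adjoin :
    SymF = Subalgebra.toSubmodule (Algebra.adjoin ℤ (Set.range (hPos ℤ))) := by
  rw [toSubmodule_adjoin_hPos]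
  exact symF_eq_span

theorem extended_symF :
    extended R SymF = Subalgebra.toSubmodule (Algebra.adjoin R (Set.range (hPos R))) := by
  rw [symF_eq_span, extended_span, toSubmodule_adjoin_hPos, ← Set.range_comp]
  simp [Function.comp_def, map_list_prod, map_complete]

theorem extended_symB : extended R SymB = Submodule.span R (Set.range (hBOver R)) := by
  rw [symB_eq_span, extended_span, ← Set.range_comp]
  simp only [Function.comp_def, map_hBOver]

theorem polyMul_adjoin (s : Set (MvPowerSeries ℕ R)) :
    polyMul R (Subalgebra.toSubmodule (Algebra.adjoin R s)) =
      Subalgebra.toSubmodule (Algebra.adjoin R (insert (X 0) s)) := by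
  rw [polyMul, ← Set.singleton_union, Algebra.adjoin_union_coe_submodule]

variable {R} in
theorem coeff_eq_zero_of_mem_adjoin_hPos {f : MvPowerSeries ℕ R}
    (hf : f ∈ Algebra.adjoin R (Set.range (hPos R))) {m : ℕ →₀ ℕ} (hm : m 0 ≠ 0) :
    coeff m f = 0 := by
  induction hf using Algebra.adjoin_induction generalizing m with
  | mem f hf =>
    obtain ⟨k, rfl⟩ := hf
    rw [coeff_hPos, if_neg fun h => hm h.2]
  | algebraMap c =>
    rw [MvPowerSeries.algebraMap_apply, coeff_C, if_neg]
    rintro rfl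
    exact hm rfl
  | add f g _ _ hf hg => rw [map_add, hf hm, hg hm, add_zero]
  | mul f g _ _ hf hg =>
    rw [coeff_mul]
    refine sum_eq_zero fun p hp => ?_
    have hsum : p.1 0 + p.2 0 ≠ 0 := by rwa [← mem_antidiagonal.1 hp] at hm
    by_cases h : p.1 0 = 0
    · rw [hg (by omega), mul_zero]
    · rw [hf h, zero_mul]

theorem range_tensorMul (U : Submodule R (MvPowerSeries ℕ R)) :
    LinearMap.range (tensorMul R U) = polyMul R U := by
  refine le_antisymm ?_ (Submodule.mul_le.2 ?_)
  · rintro _ ⟨t, rfl⟩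
    induction t with
    | zero => rw [map_zero]; exact Submodule.zero_mem _
    | add x y hx hy => rw [map_add]; exact Submodule.add_mem _ hx hy
    | tmul p f => exact Submodule.mul_mem_mul (Polynomial.aeval_mem_adjoin_singleton R (X 0)) f.2
  · intro f hf g hg
    rw [Subalgebra.mem_toSubmodule, Algebra.adjoin_singleton_eq_range_aeval] at hf
    obtain ⟨p, rfl⟩ := hf
    exact ⟨p ⊗ₜ ⟨g, hg⟩, rfl⟩

variable {R}

theorem coeff_X_pow_mul_eq_ite {f : MvPowerSeries ℕ R} (hf : ∀ m : ℕ →₀ ℕ, m 0 ≠ 0 → coeff m f = 0)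
    {m : ℕ →₀ ℕ} (hm : m 0 = 0) (k n : ℕ) :
    coeff (m + Finsupp.single 0 n) (X 0 ^ k * f) = if k = n then coeff m f else 0 := by
  rw [X_pow_eq, coeff_monomial_mul, one_mul]
  split_ifs with hle hkn hkn
  · rw [hkn, add_tsub_cancel_right]
  · refine hf _ ?_
    have hlt : k < n := lt_of_le_of_ne (by simpa [hm] using Finsupp.single_le_iff.1 hle) hkn
    simpa [hm] using Nat.sub_ne_zero_of_lt hlt
  · exact absurd (hkn ▸ le_add_self) hle
  · rfl

theorem tensorMul_injective {U : Submodule R (MvPowerSeries ℕ R)}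
    (hU : ∀ f ∈ U, ∀ m : ℕ →₀ ℕ, m 0 ≠ 0 → coeff m f = 0) :
    Function.Injective (tensorMul R U) := by
  set e := TensorProduct.equivFinsuppOfBasisLeft (N := U) (Polynomial.basisMonomials R)
  have htensor (u : ℕ →₀ U) : tensorMul R U (e.symm u) = u.sum fun k f => X 0 ^ k * f.1 := by
    rw [TensorProduct.equivFinsuppOfBasisLeft_symm_apply, Finsupp.sum, map_sum]
    refine sum_congr rfl fun k _ => ?_
    change Polynomial.aeval (X 0) (Polynomial.basisMonomials R k) * (u k).1 = _
    rw [Polynomial.coe_basisMonomials, Polynomial.aeval_monomial, map_one, one_mul]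
  rw [injective_iff_map_eq_zero]
  intro t hu
  obtain ⟨u, rfl⟩ := e.symm.surjective t
  rw [e.symm.map_eq_zero_iff]
  ext n m
  change coeff m (u n).1 = 0
  by_cases hm : m 0 = 0
  · have hcoeff := congrArg (coeff (m + Finsupp.single 0 n)) ((htensor u).symm.trans hu)
    rw [Finsupp.sum, map_sum, map_zero,
      sum_congr rfl fun k _ => coeff_X_pow_mul_eq_ite (hU _ (u k).2) hm k n, sum_ite_eq'] at hcoeff
    by_contra hne
    rw [if_pos (Finsupp.mem_support_iff.2 fun h => hne (by rw [h]; exact map_zero _))] at hcoeff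
    exact hne hcoeff
  · exact hU _ (u n).2 m hm

theorem tensorMul_adjoin_hPos_injective :
    Function.Injective
      (tensorMul R (Subalgebra.toSubmodule (Algebra.adjoin R (Set.range (hPos R))))) :=
  tensorMul_injective fun _ hf _ => coeff_eq_zero_of_mem_adjoin_hPos hf

variable (R)

theorem scalarExt_injective [Module.Flat ℤ R] {U : Submodule ℤ (MvPowerSeries ℕ ℤ)}
    (hU : U ≤ Submodule.span ℤ (Set.range (mOver ℤ))) : Function.Injective (scalarExt R U) := by
  set W := Submodule.span ℤ (Set.range (mOver ℤ))
  let b : Module.Basis PseudoPart ℤ W := Module.Basis.span linearIndependent_mOver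
  have hb (l : PseudoPart) : (b l : MvPowerSeries ℕ ℤ) = mOver ℤ l :=
    congrArg Subtype.val (Module.Basis.span_apply _ l)
  have hbasis : scalarExt R W =
      Finsupp.linearCombination R (mOver R) ∘ₗ (b.baseChange R).repr.toLinearMap := by
    refine (b.baseChange R).ext fun l => ?_
    rw [LinearMap.comp_apply, LinearEquiv.coe_coe, Module.Basis.repr_self,
      Finsupp.linearCombination_single, Module.Basis.baseChange_apply, scalarExt_tmul,
      hb, map_mOver]
  have hW : Function.Injective (scalarExt R W) := by
    rw [hbasis, LinearMap.coe_comp]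
    exact Function.Injective.comp linearIndependent_mOver (b.baseChange R).repr.injective
  have hfactor : scalarExt R U =
      scalarExt R W ∘ₗ TensorProduct.AlgebraTensorModule.lTensor R R (Submodule.inclusion hU) := by
    ext : 3
    rfl
  rw [hfactor]
  exact hW.comp (Module.Flat.lTensor_preserves_injective_linearMap (M := R) _
    (Submodule.inclusion_injective hU))

theorem symB_le_span_mOver : SymB ≤ Submodule.span ℤ (Set.range (mOver ℤ)) := by
  rw [symB_eq_span, Submodule.span_le]
  rintro _ ⟨α, rfl⟩
  exact Submodule.span_mono (Set.image_subset_range _ _) (hBOver_mem_span_mOver α)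

theorem symF_le_span_mOver : SymF ≤ Submodule.span ℤ (Set.range (mOver ℤ)) := by
  rw [symF_eq_span, Submodule.span_le]
  rintro _ ⟨α, rfl⟩
  exact Submodule.span_mono (Set.image_subset_range _ _) (prod_hPos_mem_span_mOver α.1)

end scalars

theorem symB_le_polyMul : SymB ≤ polyMul ℤ SymF := by
  rw [symB_eq_span]
  refine Submodule.span_le.2 ?_
  rintro _ ⟨α, rfl⟩
  change hBOver ℤ α ∈ polyMul ℤ SymF
  rw [symF_eq_adjoin, polyMul_adjoin]
  exact hBOver_mem_adjoin_hPos α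

theorem X_pow_mem_polyMul_symF (n : ℕ) : (X 0 : MvPowerSeries ℕ ℤ) ^ n ∈ polyMul ℤ SymF := by
  rw [symF_eq_adjoin, polyMul_adjoin]
  exact Subalgebra.pow_mem _ (Algebra.subset_adjoin (Set.mem_insert _ _)) n

theorem three_mul_X_sq (R : Type*) [CommRing R] : (3 : MvPowerSeries ℕ R) * X 0 ^ 2 =
    8 * hAll R 2 - 4 * (hAll R 1 * hDbl R 1) - 4 * hDbl R 2 + 3 * (hDbl R 1 * hDbl R 1) := by
  simp only [hDbl, hAll_eq_sum, Nat.sum_antidiagonal_eq_sum_range_succ_mk, sum_range_succ,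
    sum_range_zero, hPos_zero]
  norm_num [hPos_zero]
  ring

theorem X_sq_notMem_symB : (X 0 : MvPowerSeries ℕ ℤ) ^ 2 ∉ SymB := by
  intro hX
  let l₁ : PseudoPart := ⟨⟨2, [], by simp⟩, by simp⟩
  let l₂ : PseudoPart := ⟨⟨1, [1], by simp⟩, by simp⟩
  let l₃ : PseudoPart := ⟨⟨0, [2], by simp⟩, by simp⟩
  let l₄ : PseudoPart := ⟨⟨0, [1, 1], by simp⟩, by simp⟩
  obtain ⟨v, hv⟩ : ∃ v : SymB, (v : MvPowerSeries ℕ ℤ) = X 0 ^ 2 := ⟨⟨_, hX⟩, rfl⟩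
  have hexpand : (3 : ℤ) • v = (8 : ℤ) • hBasisInt l₁ - (4 : ℤ) • hBasisInt l₂ -
      (4 : ℤ) • hBasisInt l₃ + (3 : ℤ) • hBasisInt l₄ := by
    refine Subtype.ext ?_
    simpa [hv, coe_hBasisInt, hBOver, hAll_zero, l₁, l₂, l₃, l₄] using three_mul_X_sq ℤ
  -- The coefficient of `hᴮ_{(2)}` in `x₀²` would be `8 / 3`.
  have hcoeff : 3 * hBasisInt.repr v l₁ = 8 := by
    simpa [show l₂ ≠ l₁ by simp [l₁, l₂], show l₃ ≠ l₁ by simp [l₁, l₃],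
      show l₄ ≠ l₁ by simp [l₁, l₄]] using congrArg (hBasisInt.repr · l₁) hexpand
  omega

theorem symB_lt_polyMul : SymB < polyMul ℤ SymF :=
  lt_of_le_of_ne symB_le_polyMul fun h => X_sq_notMem_symB (h ▸ X_pow_mem_polyMul_symF 2)

section rational

variable (R : Type*) [CommRing R] [Algebra ℚ R]

theorem extended_symB_eq_polyMul : extended R SymB = polyMul R (extended R SymF) := by
  rw [extended_symF, polyMul_adjoin, adjoin_insert_hPos_eq, extended_symB]

/-- The basis of `Symᴮ_R` consisting of the `hᴮ_λ`. -/
def hBasis : Module.Basis PseudoPart R (extended R SymB) :=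
  (Module.Basis.span (linearIndependent_hBOver_of_rat R)).map
    (LinearEquiv.ofEq _ _ (by rw [range_hBOver_part, extended_symB]))

theorem coe_hBasis (l : PseudoPart) : (hBasis R l : MvPowerSeries ℕ R) = hBOver R l.1 := by
  rw [hBasis, Module.Basis.map_apply, LinearEquiv.coe_ofEq_apply, Module.Basis.span_apply]

/-- The basis of `Symᴮ_R` consisting of the `mᴮ_λ`. -/
def mBasis : Module.Basis PseudoPart R (extended R SymB) :=
  (Module.Basis.span linearIndependent_mOver).map
    (LinearEquiv.ofEq _ _ (by rw [span_mOver_eq, extended_symB]))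

theorem coe_mBasis (l : PseudoPart) : (mBasis R l : MvPowerSeries ℕ R) = mOver R l := by
  rw [mBasis, Module.Basis.map_apply, LinearEquiv.coe_ofEq_apply, Module.Basis.span_apply]

end rational

/-! ### Descents of words -/

/-- The `i`-th letter of a word `u`, with the convention `u₀ = 0` of type B descents. -/
def letter (u : List ℤ) (i : ℕ) : ℤ := (0 :: u).getD i 0

theorem letter_zero (u : List ℤ) : letter u 0 = 0 := rfl

theorem letter_succ (u : List ℤ) (i : ℕ) : letter u (i + 1) = u.getD i 0 := rfl

theorem letter_append_of_le (u v : List ℤ) {i : ℕ} (hi : i ≤ u.length) :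
    letter (u ++ v) i = letter u i :=
  List.getD_append (0 :: u) v 0 i (Nat.lt_succ_of_le hi)

theorem letter_append_length_add (u v : List ℤ) {j : ℕ} (hj : j ≠ 0) :
    letter (u ++ v) (u.length + j) = letter v j := by
  obtain ⟨j, rfl⟩ := Nat.exists_eq_succ_of_ne_zero hj
  rw [Nat.succ_eq_add_one, ← add_assoc, letter_succ, letter_succ,
    List.getD_append_right _ _ _ _ (Nat.le_add_right _ _), Nat.add_sub_cancel_left]

theorem eq_of_letter_eq {u v : List ℤ} (hlen : u.length = v.length)
    (h : ∀ i ∈ Icc 1 u.length, letter u i = letter v i) : u = v := by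
  refine List.ext_getElem hlen fun i hu hv => ?_
  simpa [letter_succ, hu, hv] using h (i + 1) (mem_Icc.2 ⟨by omega, hu⟩)

/-- The type B descent set `{i ∈ {0, …, n-1} : u_i > u_{i+1}}` of a word `u` of length `n`. -/
def wordDescents (u : List ℤ) : Finset ℕ :=
  (range u.length).filter fun i => letter u (i + 1) < letter u i

theorem mem_wordDescents {u : List ℤ} {i : ℕ} :
    i ∈ wordDescents u ↔ i < u.length ∧ letter u (i + 1) < letter u i := by
  simp [wordDescents]

theorem pairwise_le_iff_letter_le (u : List ℤ) :
    u.Pairwise (· ≤ ·) ↔ ∀ i ∈ Ico 1 u.length, letter u i ≤ letter u (i + 1) := by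
  rw [← List.isChain_iff_pairwise, List.isChain_iff_getElem]
  constructor
  · intro h i hi
    obtain ⟨hi₁, hi₂⟩ := mem_Ico.1 hi
    obtain ⟨i, rfl⟩ := Nat.exists_eq_add_of_le' hi₁
    simpa [letter_succ, hi₂, Nat.lt_of_succ_lt hi₂] using h i hi₂
  · intro h i hi
    simpa [letter_succ, hi, Nat.lt_of_succ_lt hi] using h (i + 1) (mem_Ico.2 ⟨by omega, hi⟩)

theorem wordDescents_eq_empty_iff (u : List ℤ) :
    wordDescents u = ∅ ↔ u.Pairwise (· ≤ ·) ∧ ∀ a ∈ u, 0 ≤ a := by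
  rw [and_comm, ← List.pairwise_cons, pairwise_le_iff_letter_le, eq_empty_iff_forall_notMem]
  constructor
  · intro h i hi
    obtain ⟨hi₁, hi₂⟩ := mem_Ico.1 hi
    obtain ⟨i, rfl⟩ := Nat.exists_eq_add_of_le' hi₁
    exact not_lt.1 fun hlt => h i (mem_wordDescents.2 ⟨Nat.lt_of_succ_lt_succ hi₂, hlt⟩)
  · intro h i hi
    obtain ⟨hlen, hlt⟩ := mem_wordDescents.1 hi
    exact hlt.not_ge (h (i + 1) (mem_Ico.2 ⟨by omega, Nat.succ_lt_succ hlen⟩))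

theorem wordDescents_append_subset_insert_iff (u v : List ℤ) {D : Finset ℕ}
    (hD : D ⊆ range u.length) : wordDescents (u ++ v) ⊆ insert u.length D ↔
      wordDescents u ⊆ D ∧ v.Pairwise (· ≤ ·) := by
  rw [pairwise_le_iff_letter_le]
  constructor
  · refine fun h => ⟨fun i hi => ?_, fun j hj => ?_⟩
    · obtain ⟨hlen, hlt⟩ := mem_wordDescents.1 hi
      rw [← letter_append_of_le u v hlen, ← letter_append_of_le u v hlen.le] at hlt
      exact (mem_insert.1 (h (mem_wordDescents.2 ⟨by simp; omega, hlt⟩))).resolve_left hlen.ne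
    · obtain ⟨hj₁, hj₂⟩ := mem_Ico.1 hj
      by_contra! hlt
      rw [← letter_append_length_add u v (by omega), ← add_assoc,
        ← letter_append_length_add u v (by omega)] at hlt
      rcases mem_insert.1 (h (mem_wordDescents.2 ⟨by simp; omega, hlt⟩)) with heq | hmem
      · omega
      · have := mem_range.1 (hD hmem)
        omega
  · rintro ⟨hu, hv⟩ i hi
    obtain ⟨hlen, hlt⟩ := mem_wordDescents.1 hi
    rw [mem_insert]
    rcases lt_trichotomy i u.length with hiu | rfl | hiu
    · rw [letter_append_of_le u v hiu, letter_append_of_le u v hiu.le] at hlt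
      exact Or.inr (hu (mem_wordDescents.2 ⟨hiu, hlt⟩))
    · exact Or.inl rfl
    · obtain ⟨j, rfl⟩ := Nat.exists_eq_add_of_le hiu.le
      rw [add_assoc, letter_append_length_add u v (by omega),
        letter_append_length_add u v (by omega)] at hlt
      rw [List.length_append] at hlen
      exact absurd hlt (hv j (mem_Ico.2 (by omega))).not_gt

theorem ncHBComp_snoc (α : PseudoComp) (k : ℕ) (hk : 0 < k) :
    ncHBComp (α.snoc k hk) = ncMul (ncHBComp α) (ncH k) := by
  simp [ncHBComp, PseudoComp.snoc, List.foldl_append]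

theorem ncHBComp_apply (α : PseudoComp) (w : List ℤ) : ncHBComp α w =
    if w.length = α.size ∧ wordDescents w ⊆ α.descents then 1 else 0 := by
  induction α using PseudoComp.snoc_induction generalizing w with
  | single n =>
    refine if_congr (and_congr ?_ ?_) rfl rfl
    · rw [PseudoComp.size_single, PseudoComp.single]
    · rw [PseudoComp.descents_single, subset_empty, wordDescents_eq_empty_iff]
  | snoc α k hk ih =>
    have hterm (i : ℕ) (hi : i ≤ w.length) : ncHBComp α (w.take i) * ncH k (w.drop i) =
        if i = α.size then
          if w.length = α.size + k ∧ wordDescents w ⊆ insert α.size α.descents then 1 else 0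
        else 0 := by
      have hsize : (w.take i).length = i := List.length_take_of_le hi
      rw [ih, ncH, ite_zero_mul_ite_zero, one_mul, ← ite_and, hsize, List.length_drop]
      refine if_congr ?_ rfl rfl
      by_cases hi' : i = α.size
      · have hsplit := wordDescents_append_subset_insert_iff (w.take i) (w.drop i)
          (D := α.descents) (by rw [hsize, hi']; exact α.descents_subset_range)
        rw [List.take_append_drop, hsize] at hsplit
        rw [← hi', hsplit]
        have : w.length - i = k ↔ w.length = i + k := by omega
        tauto
      · tauto
    rw [ncHBComp_snoc, ncMul, sum_congr rfl fun i hi =>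
      hterm i (Nat.le_of_lt_succ (mem_range.1 hi)), sum_ite_eq', PseudoComp.size_snoc,
      PseudoComp.descents_snoc, ← ite_and]
    refine if_congr (and_iff_right_of_imp fun h => mem_range.2 ?_) rfl rfl
    omega

theorem coeff_hB_eq_card (β : PseudoComp) {m : ℕ →₀ ℕ} (hm : m.degree = β.size) :
    coeff m (hB β) =
      (Nat.card {u : List ℤ // content u = m ∧ wordDescents u ⊆ β.descents} : ℤ) := by
  have hcoeff (u : List ℤ) (hu : u ∈ (words_finite Set.univ m).toFinset) :
      ncHBComp β u = if wordDescents u ⊆ β.descents then 1 else 0 := by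
    obtain ⟨-, rfl⟩ := mem_words.1 ((Set.Finite.mem_toFinset _).1 hu)
    rw [ncHBComp_apply, ← hm, degree_content]
    exact if_congr (and_iff_right rfl) rfl rfl
  rw [hB, chiB, coeff_commutize, sum_congr rfl hcoeff, ← sum_filter, sum_const, nsmul_one,
    Nat.subtype_card]
  intro u
  simp [mem_words]

/-! ### The level function of a descent set -/

/-- The number of elements of `D` below `j`.  For `D = D(α)` this is the `j`-th letter of the least
word `0^{α₁} 1^{α₂} 2^{α₃} ⋯` with exponents `α`. -/
def level (D : Finset ℕ) (j : ℕ) : ℕ := #{d ∈ D | d < j}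

theorem level_zero (D : Finset ℕ) : level D 0 = 0 := by simp [level]

theorem level_le_card (D : Finset ℕ) (j : ℕ) : level D j ≤ #D := card_filter_le _ _

theorem level_mono (D : Finset ℕ) : Monotone (level D) := fun _ _ hij =>
  card_le_card (monotone_filter_right _ fun _ _ h => lt_of_lt_of_le h hij)

theorem level_lt_level_succ_iff {D : Finset ℕ} {j : ℕ} :
    level D j < level D (j + 1) ↔ j ∈ D := by
  constructor
  · intro h
    by_contra hj
    refine h.ne (congrArg card (filter_congr fun d hd => ?_))
    have : d ≠ j := fun h => hj (h ▸ hd)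
    omega
  · intro h
    refine card_lt_card ⟨monotone_filter_right _ fun _ _ h => Nat.lt_succ_of_lt h, fun hsub => ?_⟩
    exact (mem_filter.1 (hsub (mem_filter.2 ⟨h, Nat.lt_succ_self j⟩))).2.false

/-- The monomial `∏_{1 ≤ j ≤ n} x_{level D j}`, which for `D = D(α)`, `n = |α|` is
`x₀^{α₁} x₁^{α₂} x₂^{α₃} ⋯`. -/
def levelContent (D : Finset ℕ) (n : ℕ) : ℕ →₀ ℕ := ∑ j ∈ Icc 1 n, Finsupp.single (level D j) 1

theorem degree_levelContent (D : Finset ℕ) (n : ℕ) : (levelContent D n).degree = n := by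
  simp [levelContent]

theorem levelContent_apply_eq_zero {D : Finset ℕ} {n c : ℕ} (hc : #D < c) :
    levelContent D n c = 0 := by
  rw [levelContent, Finsupp.finsetSum_apply]
  exact sum_eq_zero fun j _ =>
    Finsupp.single_eq_of_ne' ((level_le_card D j).trans_lt hc).ne

theorem levelContent_insert {D : Finset ℕ} {n : ℕ} (hD : D ⊆ range n) (k : ℕ) :
    levelContent (insert n D) (n + k) = levelContent D n + Finsupp.single (#D + 1) k := by
  induction k with
  | zero =>
    rw [add_zero, Finsupp.single_zero, add_zero]
    refine sum_congr rfl fun j hj => ?_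
    rw [level, level, filter_insert, if_neg (mem_Icc.1 hj).2.not_gt]
  | succ k ih =>
    have hlevel : level (insert n D) (n + k + 1) = #D + 1 := by
      rw [level, filter_true_of_mem, card_insert_of_notMem fun h => notMem_range_self (hD h)]
      intro d hd
      rcases mem_insert.1 hd with rfl | hd
      · omega
      · have := mem_range.1 (hD hd)
        omega
    rw [levelContent, ← add_assoc, sum_Icc_succ_top (by omega), hlevel, ← levelContent, ih,
      add_assoc, ← Finsupp.single_add]

theorem shape_levelContent (α : PseudoComp) :
    shape (levelContent α.descents α.size) = α.toPart := by
  suffices h : levelContent α.descents α.size 0 = α.head ∧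
      posValues (levelContent α.descents α.size) = α.tail by
    obtain ⟨hhead, htail⟩ := (PseudoComp.toPart_eq_iff α _).1 rfl
    rw [shape_eq_iff, h.1, h.2, Multiset.coe_eq_coe]
    exact ⟨hhead, htail⟩
  induction α using PseudoComp.snoc_induction with
  | single n =>
    have hcontent : levelContent ∅ n = Finsupp.single 0 n := by simp [levelContent, level]
    rw [PseudoComp.descents_single, PseudoComp.size_single, hcontent]
    by_cases hn : n = 0 <;>
      simp [PseudoComp.single, posValues, posSupp, Finsupp.support_single, hn]
  | snoc α k hk ih =>
    rw [PseudoComp.descents_snoc, PseudoComp.size_snoc, levelContent_insert α.descents_subset_range,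
      posValues_add_single (Nat.succ_ne_zero _) hk.ne'
        (levelContent_apply_eq_zero (Nat.lt_succ_self _)), ih.2]
    simpa [ih.1, PseudoComp.snoc] using (List.perm_append_singleton k α.tail).symm

/-! ### Standardization of words -/

/-- The odd function on `ℤ` extending a function on `ℕ` that vanishes at `0`. -/
def oddExt (f : ℕ → ℤ) (a : ℤ) : ℤ := a.sign * f a.natAbs

theorem oddExt_natCast {f : ℕ → ℤ} (hf : f 0 = 0) (i : ℕ) : oddExt f i = f i := by
  rcases i.eq_zero_or_pos with rfl | hi
  · simp [oddExt, hf]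
  · simp [oddExt, Int.sign_eq_one_of_pos (Int.natCast_pos.2 hi)]

theorem oddExt_neg (f : ℕ → ℤ) (a : ℤ) : oddExt f (-a) = -oddExt f a := by simp [oddExt]

theorem natAbs_oddExt {f : ℕ → ℤ} (hf : f 0 = 0) (a : ℤ) :
    (oddExt f a).natAbs = (f a.natAbs).natAbs := by
  rcases eq_or_ne a 0 with rfl | ha
  · simp [oddExt, hf]
  · rw [oddExt, Int.natAbs_mul, Int.natAbs_sign_of_ne_zero ha, one_mul]

theorem eqOn_Icc_of_odd {f g : ℤ → ℤ} {n : ℕ} (hf : ∀ a, f (-a) = -f a) (hg : ∀ a, g (-a) = -g a)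
    (h : ∀ i ∈ Icc 1 n, f (i : ℕ) = g (i : ℕ)) : Set.EqOn f g (Set.Icc (-n) n) := by
  intro a ha
  have hzero {f : ℤ → ℤ} (hf : ∀ a, f (-a) = -f a) : f 0 = 0 := by
    have := hf 0
    rw [neg_zero] at this
    omega
  have hnat (i : ℕ) (hi : i ≤ n) : f i = g i := by
    rcases i.eq_zero_or_pos with rfl | hpos
    · rw [Nat.cast_zero, hzero hf, hzero hg]
    · exact h i (mem_Icc.2 ⟨hpos, hi⟩)
  have hle : a.natAbs ≤ n := by
    have := ha.1
    have := ha.2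
    omega
  rcases Int.natAbs_eq a with h | h
  · rw [h, hnat _ hle]
  · rw [h, hf, hg, hnat _ hle]

/-- The odd extension of the level function of `D`. -/
abbrev oddLevel (D : Finset ℕ) : ℤ → ℤ := oddExt fun j => level D j

theorem oddLevel_natCast (D : Finset ℕ) (i : ℕ) : oddLevel D i = level D i :=
  oddExt_natCast (by simp [level_zero]) i

theorem neg_mem_Icc_neg_iff {a b : ℤ} : -a ∈ Set.Icc (-b) b ↔ a ∈ Set.Icc (-b) b := by
  simp only [Set.mem_Icc]
  omega

namespace SignedPerm

variable {n : ℕ}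

theorem apply_neg (w : SignedPerm n) (a : ℤ) : w.1 (-a) = -w.1 a := w.2.1 a

theorem apply_zero (w : SignedPerm n) : w.1 0 = 0 := by
  have := apply_neg w 0
  rw [neg_zero] at this
  omega

theorem inv_apply_apply (w : SignedPerm n) (a : ℤ) : (w⁻¹).1 (w.1 a) = a :=
  Equiv.symm_apply_apply w.1 a

theorem apply_inv_apply (w : SignedPerm n) (a : ℤ) : w.1 ((w⁻¹).1 a) = a :=
  Equiv.apply_symm_apply w.1 a

theorem apply_mem_Icc (w : SignedPerm n) {a : ℤ} (ha : a ∈ Set.Icc (-n : ℤ) n) :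
    w.1 a ∈ Set.Icc (-n : ℤ) n := by
  rw [Set.mem_Icc, ← abs_le] at ha ⊢
  by_contra! h
  rw [w.1.injective (w.2.2 _ h)] at h
  omega

theorem ext_of_eqOn {v w : SignedPerm n} (h : Set.EqOn v.1 w.1 (Set.Icc (-n) n)) : v = w := by
  refine Subtype.ext (Equiv.ext fun a => ?_)
  by_cases ha : a ∈ Set.Icc (-n : ℤ) n
  · exact h ha
  · rw [Set.mem_Icc, ← abs_le, not_le] at ha
    rw [v.2.2 a ha, w.2.2 a ha]

theorem exists_eqOn {g : ℤ → ℤ} (hmaps : Set.MapsTo g (Set.Icc (-n) n) (Set.Icc (-n) n))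
    (hinj : Set.InjOn g (Set.Icc (-n) n))
    (hodd : ∀ a ∈ Set.Icc (-n : ℤ) n, g (-a) = -g a) :
    ∃ w : SignedPerm n, Set.EqOn w.1 g (Set.Icc (-n) n) := by
  classical
  let e : Equiv.Perm (Set.Icc (-n : ℤ) n) := Equiv.ofBijective (hmaps.restrict g _ _)
    (Finite.injective_iff_bijective.1 (hmaps.restrict_inj.2 hinj))
  have happly {a : ℤ} (ha : a ∈ Set.Icc (-n : ℤ) n) : Equiv.Perm.ofSubtype e a = g a :=
    Equiv.Perm.ofSubtype_apply_of_mem e ha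
  have hfix {a : ℤ} (ha : a ∉ Set.Icc (-n : ℤ) n) : Equiv.Perm.ofSubtype e a = a :=
    Equiv.Perm.ofSubtype_apply_of_not_mem e ha
  refine ⟨⟨Equiv.Perm.ofSubtype e, fun a => ?_, fun a ha => hfix fun h => ?_⟩, fun a => happly⟩
  · by_cases ha : a ∈ Set.Icc (-n : ℤ) n
    · rw [happly ha, happly (neg_mem_Icc_neg_iff.2 ha), hodd a ha]
    · rw [hfix ha, hfix (mt neg_mem_Icc_neg_iff.1 ha)]
  · exact ha.not_ge (abs_le.2 h)

theorem sum_natAbs_apply {M : Type*} [AddCommMonoid M] (w : SignedPerm n) (F : ℕ → M) :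
    ∑ i ∈ Icc 1 n, F (w.1 (i : ℕ)).natAbs = ∑ i ∈ Icc 1 n, F i := by
  have hmaps : Set.MapsTo (fun i : ℕ => (w.1 i).natAbs) (Icc 1 n : Finset ℕ)
      (Icc 1 n : Finset ℕ) := by
    intro i hi
    rw [mem_coe, mem_Icc] at hi ⊢
    have hmem := apply_mem_Icc w (a := i) ⟨by omega, by omega⟩
    have hne : w.1 i ≠ 0 := fun h => by
      have := w.1.injective (h.trans (apply_zero w).symm)
      omega
    rw [Set.mem_Icc] at hmem
    change 1 ≤ (w.1 i).natAbs ∧ (w.1 i).natAbs ≤ n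
    omega
  have hinj : Set.InjOn (fun i : ℕ => (w.1 i).natAbs) (Icc 1 n : Finset ℕ) := by
    intro i hi j hj h
    rw [mem_coe, mem_Icc] at hi hj
    rcases Int.natAbs_eq_natAbs_iff.1 h with h | h
    · exact_mod_cast w.1.injective h
    · rw [← apply_neg] at h
      have := w.1.injective h
      omega
  exact sum_nbij _ hmaps hinj (surjOn_of_injOn_of_card_le _ hmaps hinj le_rfl) fun _ _ => rfl

theorem mem_descents {w : SignedPerm n} {i : ℕ} :
    i ∈ descents w ↔ i < n ∧ w.1 (i + 1) < w.1 i := by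
  simp [descents]

/-- `w` sorts `{-n, …, n}` by the key `κ`. -/
def Sorts {Γ : Type*} [LT Γ] (w : SignedPerm n) (κ : ℤ → Γ) : Prop :=
  ∀ a ∈ Set.Icc (-n : ℤ) n, ∀ b ∈ Set.Icc (-n : ℤ) n, w.1 a < w.1 b ↔ κ a < κ b

section key

variable {Γ : Type*} [LinearOrder Γ] {κ : ℤ → Γ}

/-- The number of elements of `{-n, …, n}` with a smaller key than `a`. -/
def keyRank (n : ℕ) (κ : ℤ → Γ) (a : ℤ) : ℕ := #{b ∈ Icc (-n : ℤ) n | κ b < κ a}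

theorem Sorts.apply_eq {w : SignedPerm n} (hw : Sorts w κ) {a : ℤ}
    (ha : a ∈ Set.Icc (-n : ℤ) n) : w.1 a = keyRank n κ a - n := by
  have hmem := apply_mem_Icc w ha
  have himage : {b ∈ Icc (-n : ℤ) n | κ b < κ a} =
      (Ico (-n : ℤ) (w.1 a)).map (w⁻¹).1.toEmbedding := by
    ext b
    have hb : b ∈ Set.Icc (-n : ℤ) n ↔ w.1 b ∈ Set.Icc (-n : ℤ) n :=
      ⟨apply_mem_Icc w, fun h => inv_apply_apply w b ▸ apply_mem_Icc w⁻¹ h⟩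
    rw [mem_map_equiv, mem_filter, mem_Ico, mem_Icc, ← Set.mem_Icc]
    change _ ↔ -n ≤ w.1 b ∧ w.1 b < w.1 a
    constructor
    · rintro ⟨hmem_b, hlt⟩
      exact ⟨(hb.1 hmem_b).1, (hw b hmem_b a ha).2 hlt⟩
    · rintro ⟨hle, hlt⟩
      have hmem_b := hb.2 ⟨hle, hlt.le.trans hmem.2⟩
      exact ⟨hmem_b, (hw b hmem_b a ha).1 hlt⟩
  rw [keyRank, himage, card_map, Int.card_Ico]
  have := hmem.1
  omega

theorem Sorts.eq {v w : SignedPerm n} (hv : Sorts v κ) (hw : Sorts w κ) : v = w :=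
  ext_of_eqOn fun _ ha => (hv.apply_eq ha).trans (hw.apply_eq ha).symm

theorem keyRank_lt_keyRank {a b : ℤ} (ha : a ∈ Set.Icc (-n : ℤ) n) (h : κ a < κ b) :
    keyRank n κ a < keyRank n κ b := by
  refine card_lt_card ⟨monotone_filter_right _ fun _ _ hc => hc.trans h, fun hsub => ?_⟩
  exact (mem_filter.1 (hsub (mem_filter.2 ⟨mem_Icc.2 ha, h⟩))).2.false

theorem keyRank_add_keyRank_neg (hodd : ∀ a b, κ (-a) < κ (-b) ↔ κ b < κ a)
    (hinj : Function.Injective κ) {a : ℤ} (ha : a ∈ Set.Icc (-n : ℤ) n) :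
    keyRank n κ a + keyRank n κ (-a) = 2 * n := by
  have hneg : keyRank n κ (-a) = #{b ∈ Icc (-n : ℤ) n | κ a < κ b} := by
    rw [keyRank, ← card_map (Equiv.neg ℤ).toEmbedding]
    congr 1
    ext b
    rw [mem_map_equiv, mem_filter, mem_filter, Equiv.neg_symm, Equiv.neg_apply, hodd, mem_Icc,
      mem_Icc, neg_le_neg_iff, neg_le, and_comm (a := b ≤ _)]
  have hnot : #{b ∈ Icc (-n : ℤ) n | ¬ κ b < κ a} = #{b ∈ Icc (-n : ℤ) n | κ a < κ b} + 1 := by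
    rw [← card_insert_of_notMem (a := a) (by simp)]
    congr 1
    ext b
    rw [mem_insert, mem_filter, mem_filter, not_lt, le_iff_eq_or_lt, hinj.eq_iff, and_or_left,
      eq_comm (a := a)]
    exact or_congr_left (and_iff_right_of_imp fun h => h ▸ mem_Icc.2 ha)
  have hcard := card_filter_add_card_filter_not (s := Icc (-n : ℤ) n) fun b => κ b < κ a
  rw [hnot, ← hneg, Int.card_Icc] at hcard
  rw [keyRank]
  omega

theorem exists_sorts (hodd : ∀ a b, κ (-a) < κ (-b) ↔ κ b < κ a) (hinj : Function.Injective κ) :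
    ∃ w : SignedPerm n, Sorts w κ := by
  have hmono {a b : ℤ} (ha : a ∈ Set.Icc (-n : ℤ) n) (hb : b ∈ Set.Icc (-n : ℤ) n) :
      keyRank n κ a < keyRank n κ b ↔ κ a < κ b := by
    refine ⟨fun h => lt_of_not_ge fun hle => ?_, keyRank_lt_keyRank ha⟩
    rcases hle.eq_or_lt with heq | hlt
    · exact h.ne (congrArg _ (hinj heq.symm))
    · exact (keyRank_lt_keyRank hb hlt).not_gt h
  have hsum {a : ℤ} (ha : a ∈ Set.Icc (-n : ℤ) n) := keyRank_add_keyRank_neg hodd hinj ha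
  obtain ⟨w, hw⟩ := exists_eqOn (n := n) (g := fun a => keyRank n κ a - n)
    (fun a ha => by
      have := hsum ha
      constructor <;> dsimp only <;> omega)
    (fun a ha b hb h => hinj <| by
      have := hmono ha hb
      have := hmono hb ha
      have : (keyRank n κ a : ℤ) = keyRank n κ b := sub_left_injective h
      grind)
    (fun a ha => by
      have := hsum ha
      omega)
  refine ⟨w, fun a ha b hb => ?_⟩
  rw [hw ha, hw hb, sub_lt_sub_iff_right, Nat.cast_lt, hmono ha hb]

end key

/-- The key whose sorting permutation standardizes the word `u`: positions `-n, …, n` are compared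
by their letters, with `u₋ᵢ = -uᵢ`, and from left to right among equal letters. -/
def wordKey (u : List ℤ) (a : ℤ) : ℤ ×ₗ ℤ := toLex (oddExt (letter u) a, a)

theorem wordKey_lt_wordKey_iff {u : List ℤ} {a b : ℤ} : wordKey u a < wordKey u b ↔
    oddExt (letter u) a < oddExt (letter u) b ∨
      oddExt (letter u) a = oddExt (letter u) b ∧ a < b :=
  Prod.Lex.toLex_lt_toLex

theorem wordKey_injective (u : List ℤ) : Function.Injective (wordKey u) := fun _ _ h =>
  (Prod.mk.inj (toLex.injective h)).2

theorem wordKey_neg_lt_wordKey_neg_iff {u : List ℤ} (a b : ℤ) :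
    wordKey u (-a) < wordKey u (-b) ↔ wordKey u b < wordKey u a := by
  simp only [wordKey_lt_wordKey_iff, oddExt_neg, neg_lt_neg_iff, neg_inj,
    eq_comm (a := oddExt (letter u) a)]

theorem descents_eq_wordDescents {w : SignedPerm n} {u : List ℤ} (hlen : u.length = n)
    (hw : Sorts w (wordKey u)) : descents w = wordDescents u := by
  ext i
  rw [mem_descents, mem_wordDescents, hlen]
  refine and_congr_right fun hi => ?_
  rw [hw (i + 1) ⟨by omega, by omega⟩ i ⟨by omega, by omega⟩, wordKey_lt_wordKey_iff,
    ← Nat.cast_succ, oddExt_natCast (letter_zero u), oddExt_natCast (letter_zero u)]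
  exact or_iff_left fun h => by omega

theorem descents_subset_iff {v : SignedPerm n} {D : Finset ℕ} : descents v ⊆ D ↔
    StrictMonoOn (fun a => toLex (oddLevel D a, v.1 a)) (Set.Icc (-n : ℤ) n) := by
  constructor
  · intro h
    have hstep {i : ℕ} (hi : i < n) : oddLevel D i < oddLevel D (i + 1) ∨
        oddLevel D i = oddLevel D (i + 1) ∧ v.1 i < v.1 (i + 1) := by
      rw [← Nat.cast_succ, oddLevel_natCast, oddLevel_natCast, Nat.cast_lt, Nat.cast_inj]
      by_cases hiD : i ∈ D
      · exact Or.inl (level_lt_level_succ_iff.2 hiD)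
      · refine Or.inr ⟨(level_mono D i.le_succ).antisymm
          (not_lt.1 (mt level_lt_level_succ_iff.1 hiD)), ?_⟩
        refine (not_lt.1 fun hlt => hiD (h (mem_descents.2 ⟨hi, hlt⟩))).lt_of_ne fun heq => ?_
        have := v.1.injective heq
        omega
    refine strictMonoOn_of_lt_add_one Set.ordConnected_Icc fun a _ ha hsucc => ?_
    rw [Prod.Lex.toLex_lt_toLex]
    rcases le_or_gt 0 a with hnonneg | hneg
    · lift a to ℕ using hnonneg
      exact hstep (by exact_mod_cast hsucc.2)
    · obtain ⟨j, rfl⟩ : ∃ j : ℕ, a = -(j + 1) := ⟨(-a - 1).toNat, by omega⟩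
      have := hstep (i := j) (by have := ha.1; omega)
      rw [show -((j : ℤ) + 1) + 1 = -j by ring]
      simp only [oddExt_neg, apply_neg, neg_lt_neg_iff, neg_inj]
      rwa [eq_comm (a := oddLevel D (j + 1))]
  · intro h i hi
    obtain ⟨hin, hlt⟩ := mem_descents.1 hi
    have := h (a := i) (b := i + 1) ⟨by omega, by omega⟩ ⟨by omega, by omega⟩ (by omega)
    rw [Prod.Lex.toLex_lt_toLex] at this
    have := this.resolve_right fun h => h.2.not_gt hlt
    rwa [← Nat.cast_succ, oddLevel_natCast, oddLevel_natCast, Nat.cast_lt,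
      level_lt_level_succ_iff] at this

/-- The word `u` with letters `uᵢ = level D |w i| · sign (w i)`.  This inverts standardization
among words with content `levelContent D n`. -/
def toWord (D : Finset ℕ) (w : SignedPerm n) : List ℤ :=
  List.ofFn fun i : Fin n => oddLevel D (w.1 (i + 1))

theorem length_toWord (D : Finset ℕ) (w : SignedPerm n) : (toWord D w).length = n :=
  List.length_ofFn

theorem letter_toWord (D : Finset ℕ) (w : SignedPerm n) {i : ℕ} (hi : i ∈ Icc 1 n) :
    letter (toWord D w) i = oddLevel D (w.1 i) := by
  obtain ⟨hpos, hle⟩ := mem_Icc.1 hi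
  obtain ⟨i, rfl⟩ := Nat.exists_eq_add_of_le' hpos
  have hi : i < (toWord D w).length := (length_toWord D w).symm ▸ hle
  rw [letter_succ, List.getD_eq_getElem _ _ hi]
  simp [toWord]

theorem oddExt_letter_toWord (D : Finset ℕ) (w : SignedPerm n) :
    Set.EqOn (oddExt (letter (toWord D w))) (fun a => oddLevel D (w.1 a)) (Set.Icc (-n) n) :=
  eqOn_Icc_of_odd (oddExt_neg _) (fun a => by rw [apply_neg]; exact oddExt_neg _ _)
    fun i hi => by rw [oddExt_natCast (letter_zero _), letter_toWord D w hi]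

theorem sorts_wordKey_toWord {D : Finset ℕ} {w : SignedPerm n} (hw : descents w⁻¹ ⊆ D) :
    Sorts w (wordKey (toWord D w)) := by
  intro a ha b hb
  rw [← (descents_subset_iff.1 hw).lt_iff_lt (apply_mem_Icc w ha) (apply_mem_Icc w hb),
    Prod.Lex.toLex_lt_toLex, wordKey_lt_wordKey_iff, oddExt_letter_toWord D w ha,
    oddExt_letter_toWord D w hb]
  simp only [inv_apply_apply]

theorem content_eq_sum (u : List ℤ) :
    content u = ∑ i ∈ Icc 1 u.length, Finsupp.single (letter u i).natAbs 1 := by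
  induction u using List.reverseRecOn with
  | nil => simp [content]
  | append_singleton u a ih =>
    have hlast : letter (u ++ [a]) (u.length + 1) = a :=
      letter_append_length_add u [a] one_ne_zero
    have hsingle : content [a] = Finsupp.single a.natAbs 1 := by
      rw [content, List.map_singleton, Multiset.coe_singleton, Multiset.toFinsupp_singleton]
    rw [content_append, ih, hsingle, List.length_append, List.length_singleton,
      sum_Icc_succ_top (by omega), hlast]
    refine congrArg (· + _) (sum_congr rfl fun i hi => ?_)
    rw [letter_append_of_le u [a] (mem_Icc.1 hi).2]

theorem content_toWord (D : Finset ℕ) (w : SignedPerm n) :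
    content (toWord D w) = levelContent D n := by
  rw [content_eq_sum, length_toWord, levelContent,
    ← sum_natAbs_apply w fun i => Finsupp.single (level D i) 1]
  refine sum_congr rfl fun i hi => ?_
  rw [letter_toWord D w hi, natAbs_oddExt (by simp [level_zero]), Int.natAbs_natCast]

theorem eqOn_of_sum_single_eq {f g : ℕ → ℕ} {s : Finset ℕ} (hf : MonotoneOn f s)
    (hg : MonotoneOn g s)
    (h : ∑ i ∈ s, Finsupp.single (f i) 1 = ∑ i ∈ s, Finsupp.single (g i) 1) :
    Set.EqOn f g s := by
  have hmap (f : ℕ → ℕ) : ((s.sort).map f : Multiset ℕ) =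
      Finsupp.toMultiset (∑ i ∈ s, Finsupp.single (f i) 1) := by
    rw [map_sum, ← Multiset.map_coe, sort_eq]
    simp only [Finsupp.toMultiset_single, one_nsmul]
    exact (Multiset.sum_map_singleton _).symm.trans (congrArg _ (Multiset.map_map _ _ _))
  have hsorted {f : ℕ → ℕ} (hf : MonotoneOn f s) : (s.sort.map f).Pairwise (· ≤ ·) := by
    rw [List.pairwise_map]
    exact (s.pairwise_sort (· ≤ ·)).imp_of_mem fun ha hb hab =>
      hf ((mem_sort _).1 ha) ((mem_sort _).1 hb) hab
  have hperm : (s.sort.map f).Perm (s.sort.map g) := by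
    rw [← Multiset.coe_eq_coe, hmap, hmap, h]
  have heq := hperm.eq_of_pairwise (fun _ _ _ _ => le_antisymm) (hsorted hf) (hsorted hg)
  exact fun i hi => List.map_inj_left.1 heq i ((mem_sort _).2 hi)

theorem oddExt_letter_inv_eqOn {D : Finset ℕ} {u : List ℤ} {w : SignedPerm n}
    (hlen : u.length = n) (hu : content u = levelContent D n) (hw : Sorts w (wordKey u)) :
    Set.EqOn (fun a => oddExt (letter u) ((w⁻¹).1 a)) (oddLevel D) (Set.Icc (-n) n) := by
  have hodd (a : ℤ) : oddExt (letter u) ((w⁻¹).1 (-a)) = -oddExt (letter u) ((w⁻¹).1 a) := by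
    rw [apply_neg, oddExt_neg]
  have hmono : MonotoneOn (fun a => oddExt (letter u) ((w⁻¹).1 a)) (Set.Icc (-n) n) := by
    intro a ha b hb hab
    by_contra! hlt
    have := (hw _ (apply_mem_Icc w⁻¹ hb) _ (apply_mem_Icc w⁻¹ ha)).2
      (wordKey_lt_wordKey_iff.2 (Or.inl hlt))
    rw [apply_inv_apply, apply_inv_apply] at this
    omega
  have hcast {i : ℕ} (hi : i ≤ n) : (i : ℤ) ∈ Set.Icc (-n : ℤ) n := ⟨by omega, by omega⟩
  have hnonneg {i : ℕ} (hi : i ≤ n) : 0 ≤ oddExt (letter u) ((w⁻¹).1 i) := by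
    have := hmono (hcast n.zero_le) (hcast hi) (by omega)
    dsimp only at this
    rwa [Nat.cast_zero, apply_zero, ← Nat.cast_zero, oddExt_natCast (letter_zero u)] at this
  have habs : Set.EqOn (fun i : ℕ => (oddExt (letter u) ((w⁻¹).1 i)).natAbs) (level D)
      (Icc 1 n : Finset ℕ) := by
    refine eqOn_of_sum_single_eq (fun i hi j hj hij => ?_) ((level_mono D).monotoneOn _) ?_
    · have hi := (mem_Icc.1 hi).2
      have hj := (mem_Icc.1 hj).2
      have := hmono (hcast hi) (hcast hj) (Int.ofNat_le.2 hij)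
      have := hnonneg hi
      dsimp only at *
      omega
    · rw [← levelContent, ← hu, content_eq_sum, hlen,
        ← sum_natAbs_apply w⁻¹ fun i => Finsupp.single (letter u i).natAbs 1]
      simp only [natAbs_oddExt (letter_zero u)]
  refine eqOn_Icc_of_odd hodd (oddExt_neg _) fun i hi => ?_
  rw [oddLevel_natCast, ← habs hi, Int.natAbs_of_nonneg (hnonneg (mem_Icc.1 hi).2)]

theorem exists_toWord_eq {D : Finset ℕ} {u : List ℤ} (hu : content u = levelContent D n) :
    ∃ w : SignedPerm n, descents w⁻¹ ⊆ D ∧ toWord D w = u := by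
  have hlen : u.length = n := by rw [← degree_content, hu, degree_levelContent]
  obtain ⟨w, hw⟩ := exists_sorts (n := n) (wordKey_neg_lt_wordKey_neg_iff (u := u))
    (wordKey_injective u)
  have heq := oddExt_letter_inv_eqOn hlen hu hw
  refine ⟨w, descents_subset_iff.2 fun a ha b hb hab => ?_,
    eq_of_letter_eq (by rw [length_toWord, hlen]) fun i hi => ?_⟩
  · rw [Prod.Lex.toLex_lt_toLex, ← heq ha, ← heq hb]
    exact wordKey_lt_wordKey_iff.1 <| (hw _ (apply_mem_Icc w⁻¹ ha) _ (apply_mem_Icc w⁻¹ hb)).1 <| by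
      rwa [apply_inv_apply, apply_inv_apply]
  · rw [length_toWord] at hi
    obtain ⟨hpos, hle⟩ := mem_Icc.1 hi
    rw [letter_toWord D w hi, ← heq (apply_mem_Icc w ⟨by omega, by omega⟩)]
    dsimp only
    rw [inv_apply_apply, oddExt_natCast (letter_zero u)]

theorem bijOn_toWord (D E : Finset ℕ) : Set.BijOn (toWord D)
    {w : SignedPerm n | descents w⁻¹ ⊆ D ∧ descents w ⊆ E}
    {u | content u = levelContent D n ∧ wordDescents u ⊆ E} := by
  have hdesc {w : SignedPerm n} (hw : descents w⁻¹ ⊆ D) : descents w = wordDescents (toWord D w) :=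
    descents_eq_wordDescents (length_toWord D w) (sorts_wordKey_toWord hw)
  refine ⟨fun w hw => ⟨content_toWord D w, hdesc hw.1 ▸ hw.2⟩, fun v hv w hw heq => ?_, ?_⟩
  · exact (sorts_wordKey_toWord hv.1).eq (heq ▸ sorts_wordKey_toWord hw.1)
  · rintro u ⟨hu, hdesc_u⟩
    obtain ⟨w, hw, rfl⟩ := exists_toWord_eq hu
    exact ⟨w, ⟨hw, hdesc hw ▸ hdesc_u⟩, rfl⟩

end SignedPerm

theorem coeff_levelContent_hB (D : Finset ℕ) (β : PseudoComp) :
    coeff (levelContent D β.size) (hB β) = (Nat.card {w : SignedPerm β.size //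
      SignedPerm.descents w⁻¹ ⊆ D ∧ SignedPerm.descents w ⊆ β.descents} : ℤ) := by
  rw [coeff_hB_eq_card β (degree_levelContent D _)]
  exact congrArg _ (Nat.card_congr (SignedPerm.bijOn_toWord D β.descents).equiv).symm

/-! ### The bilinear form -/

instance (n : ℕ) : Finite (SignedPerm n) :=
  Finite.of_injective (fun w => Set.MapsTo.restrict w.1 (Set.Icc (-n : ℤ) n) (Set.Icc (-n : ℤ) n)
      fun _ => SignedPerm.apply_mem_Icc w)
    fun _ _ h => SignedPerm.ext_of_eqOn fun a ha => congrArg Subtype.val (congrFun h ⟨a, ha⟩)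

theorem formCoeff_of_size_eq {α β : PseudoComp} (h : α.size = β.size) : formCoeff α β =
    Nat.card {w : SignedPerm β.size // SignedPerm.descents w⁻¹ = α.descents ∧
      SignedPerm.descents w = β.descents} :=
  if_pos h

theorem formCoeff_comm (α β : PseudoComp) : formCoeff α β = formCoeff β α := by
  by_cases h : α.size = β.size
  · rw [formCoeff_of_size_eq h, formCoeff_of_size_eq h.symm, h]
    refine Nat.card_congr ((Equiv.inv (SignedPerm β.size)).subtypeEquiv fun w => ?_)
    rw [Equiv.inv_apply, inv_inv, and_comm]
  · rw [formCoeff, formCoeff, if_neg h, if_neg (Ne.symm h)]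

theorem finite_setOf_coarser (α : PseudoComp) : {β : PseudoComp | β.Coarser α}.Finite :=
  (PseudoComp.finite_setOf_size_le α.size).subset fun _ h => h.1.le

/-- The finite set of all `β ≼ α`. -/
def coarsenings (α : PseudoComp) : Finset PseudoComp := (finite_setOf_coarser α).toFinset

theorem mem_coarsenings {α β : PseudoComp} : β ∈ coarsenings α ↔ β.Coarser α := by
  simp [coarsenings]

theorem sum_coarsenings {M : Type*} [AddCommMonoid M] (α : PseudoComp) (f : Finset ℕ → M) :
    ∑ β ∈ coarsenings α, f β.descents = ∑ S ∈ α.descents.powerset, f S := by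
  refine sum_nbij PseudoComp.descents (fun β hβ => mem_powerset.2 (mem_coarsenings.1 hβ).2)
    (fun β hβ γ hγ h => ?_) (fun S hS => ?_) fun _ _ => rfl
  · exact PseudoComp.eq_of_size_of_descents
      ((mem_coarsenings.1 hβ).1.trans (mem_coarsenings.1 hγ).1.symm) h
  · have hS : S ⊆ α.descents := mem_powerset.1 hS
    obtain ⟨β, hsize, rfl⟩ := PseudoComp.exists_size_eq_descents_eq α.size
      (hS.trans α.descents_subset_range)
    exact ⟨β, mem_coarsenings.2 ⟨hsize, hS⟩, rfl⟩

theorem sum_powerset_neg_one_pow_ite_subset {ι : Type*} [DecidableEq ι] (R : Type*) [CommRing R]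
    (D T : Finset ι) : ∑ S ∈ D.powerset, (-1 : R) ^ (#D - #S) * (if T ⊆ S then 1 else 0) =
      if T = D then 1 else 0 := by
  by_cases hT : T ⊆ D
  · have hcompl : ∑ S ∈ D.powerset with T ⊆ S, (-1 : R) ^ (#D - #S) =
        ∑ S ∈ (D \ T).powerset, (-1 : R) ^ #S := by
      refine sum_nbij' (D \ ·) (D \ ·) ?_ ?_ ?_ ?_ fun S hS => ?_
      · grind
      · grind
      · grind
      · grind
      · rw [card_sdiff_of_subset (mem_powerset.1 (mem_filter.1 hS).1)]
    have hzero := congrArg (Int.cast : ℤ → R) (sum_powerset_neg_one_pow_card (x := D \ T))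
    push_cast at hzero
    simp only [mul_ite, mul_one, mul_zero]
    rw [← sum_filter, hcompl, hzero]
    exact if_congr (sdiff_eq_empty_iff_subset.trans ⟨hT.antisymm, fun h => h.ge⟩) rfl rfl
  · rw [if_neg fun h => hT h.subset]
    refine sum_eq_zero fun S hS => ?_
    rw [if_neg fun h => hT (h.trans (mem_powerset.1 hS)), mul_zero]

theorem sum_coarsenings_neg_one_pow_ite_subset (R : Type*) [CommRing R] (α : PseudoComp)
    (T : Finset ℕ) : ∑ β ∈ coarsenings α,
      (-1 : R) ^ (α.length - β.length) * (if T ⊆ β.descents then 1 else 0) =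
        if T = α.descents then 1 else 0 := by
  simp only [PseudoComp.length_eq_card_descents, Nat.add_sub_add_right]
  rw [sum_coarsenings α fun S => (-1 : R) ^ (#α.descents - #S) * (if T ⊆ S then 1 else 0),
    sum_powerset_neg_one_pow_ite_subset]

theorem sum_ite_mul_ite {ι R : Type*} [Fintype ι] [CommSemiring R] (p q : ι → Prop)
    [DecidablePred p] [DecidablePred q] :
    ∑ i, (if p i then (1 : R) else 0) * (if q i then 1 else 0) =
      (Nat.card {i // p i ∧ q i} : R) := by
  simp only [ite_zero_mul_ite_zero, one_mul]
  rw [Nat.card_eq_fintype_card, Fintype.card_subtype, sum_boole]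

theorem nondegenerate_of_apply_eq_repr {R M ι : Type*} [CommRing R] [AddCommGroup M] [Module R M]
    {B : LinearMap.BilinForm R M} (b c : Module.Basis ι R M)
    (h : ∀ i y, B (b i) y = c.repr y i) : B.Nondegenerate := by
  classical
  have hflip (j : ι) : LinearMap.BilinForm.flip B (c j) = b.coord j := b.ext fun i => by
    rw [LinearMap.BilinForm.flip_apply, h, Module.Basis.repr_self_apply, Module.Basis.coord_apply,
      Module.Basis.repr_self_apply]
    exact if_congr eq_comm rfl rfl
  refine ⟨fun x hx => b.forall_coord_eq_zero_iff.1 fun j => ?_,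
    fun y hy => c.forall_coord_eq_zero_iff.1 fun i => ?_⟩
  · rw [← hflip, LinearMap.BilinForm.flip_apply, hx]
  · rw [Module.Basis.coord_apply, ← h, hy]

section form

variable (R : Type*) [CommRing R]

/-- The element `hᴮ_α` of `Symᴮ_R`. -/
def hExt (α : PseudoComp) : extended R SymB :=
  ⟨hBOver R α, by rw [extended_symB]; exact Submodule.subset_span ⟨α, rfl⟩⟩

theorem coe_sB (α : PseudoComp) : (sB α : MvPowerSeries ℕ ℤ) =
    ∑ β ∈ coarsenings α, (-1 : ℤ) ^ (α.length - β.length) • hBOver ℤ β := by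
  change chiB (ncSBComp α) = _
  rw [ncSBComp, finsum_mem_eq_finite_toFinset_sum _ (finite_setOf_coarser α), map_sum]
  exact sum_congr rfl fun β _ => by rw [map_smul, ← hB_eq, hB]

theorem toExtended_sB (α : PseudoComp) : toExtended R (sB α) =
    ∑ β ∈ coarsenings α, (-1 : R) ^ (α.length - β.length) • hExt R β := by
  refine Subtype.ext ?_
  rw [AddSubmonoidClass.coe_finsetSum]
  change scalarExt R SymB (1 ⊗ₜ sB α) = ∑ β ∈ coarsenings α,
    (-1 : R) ^ (α.length - β.length) • hBOver R β
  rw [scalarExt_tmul, one_smul, coe_sB, map_sum]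
  refine sum_congr rfl fun β _ => ?_
  rw [map_zsmul, map_hBOver, ← Int.cast_smul_eq_zsmul R]
  push_cast
  rfl

theorem hExt_mem_span_toExtended_sB (α : PseudoComp) :
    hExt R α ∈ Submodule.span R (Set.range fun α => toExtended R (sB α)) := by
  induction hn : #α.descents using Nat.strong_induction_on generalizing α with
  | _ n ih =>
    classical
    have hmem : α ∈ coarsenings α := mem_coarsenings.2 ⟨rfl, subset_rfl⟩
    have hsum := toExtended_sB R α
    rw [← add_sum_erase _ _ hmem, Nat.sub_self, pow_zero, one_smul, ← sub_eq_iff_eq_add] at hsum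
    rw [← hsum]
    refine Submodule.sub_mem _ (Submodule.subset_span ⟨α, rfl⟩)
      (Submodule.sum_mem _ fun β hβ => Submodule.smul_mem _ _ (ih _ ?_ β rfl))
    obtain ⟨hne, hβ⟩ := mem_erase.1 hβ
    obtain ⟨hsize, hsub⟩ := mem_coarsenings.1 hβ
    rw [← hn]
    exact card_lt_card (hsub.ssubset_of_ne fun h => hne (PseudoComp.eq_of_size_of_descents hsize h))

variable [Algebra ℚ R]

theorem hBasis_toPart (α : PseudoComp) : hBasis R α.toPart = hExt R α :=
  Subtype.ext (by rw [coe_hBasis, hBOver_toPart]; rfl)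

theorem span_toExtended_sB :
    Submodule.span R (Set.range fun α => toExtended R (sB α)) = ⊤ := by
  rw [eq_top_iff, ← (hBasis R).span_eq, Submodule.span_le]
  rintro _ ⟨l, rfl⟩
  rw [← PseudoComp.toPart_val l, hBasis_toPart]
  exact hExt_mem_span_toExtended_sB R l.1

variable {R} in
theorem bilinForm_ext_sB {B B' : LinearMap.BilinForm R (extended R SymB)}
    (h : ∀ α β, B (toExtended R (sB α)) (toExtended R (sB β)) =
      B' (toExtended R (sB α)) (toExtended R (sB β))) : B = B' := by
  refine LinearMap.ext_on (span_toExtended_sB R) ?_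
  rintro _ ⟨α, rfl⟩
  refine LinearMap.ext_on (span_toExtended_sB R) ?_
  rintro _ ⟨β, rfl⟩
  exact h α β

theorem mBasis_repr_shape (m : ℕ →₀ ℕ) (f : extended R SymB) :
    (mBasis R).repr f (shape m) = coeff m f.1 := by
  classical
  suffices h : (mBasis R).coord (shape m) = coeff m ∘ₗ (extended R SymB).subtype from
    LinearMap.congr_fun h f
  refine (mBasis R).ext fun l => ?_
  rw [Module.Basis.coord_apply, Module.Basis.repr_self_apply, LinearMap.comp_apply,
    Submodule.subtype_apply, coe_mBasis, coeff_mOver]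
  exact if_congr eq_comm rfl rfl

/-- The bilinear form on `Symᴮ_R` for which `hᴮ_λ` and `mᴮ_λ` are dual bases. -/
def symForm : LinearMap.BilinForm R (extended R SymB) :=
  (hBasis R).constr R (mBasis R).coord

theorem symForm_hBasis (l : PseudoPart) (f : extended R SymB) :
    symForm R (hBasis R l) f = (mBasis R).repr f l := by
  rw [symForm, Module.Basis.constr_basis, Module.Basis.coord_apply]

theorem symForm_hExt (α : PseudoComp) (f : extended R SymB) :
    symForm R (hExt R α) f = coeff (levelContent α.descents α.size) f.1 := by
  rw [← hBasis_toPart, symForm_hBasis, ← shape_levelContent, mBasis_repr_shape]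

theorem symForm_hExt_hExt_of_size_ne {α β : PseudoComp} (h : α.size ≠ β.size) :
    symForm R (hExt R α) (hExt R β) = 0 := by
  rw [symForm_hExt]
  exact IsHomogeneous.coeff_eq_zero (isHomogeneous_hBOver β) (by rwa [degree_levelContent])

theorem symForm_hExt_hExt {n : ℕ} [Fintype (SignedPerm n)] {α β : PseudoComp} (hα : α.size = n)
    (hβ : β.size = n) : symForm R (hExt R α) (hExt R β) = ∑ w : SignedPerm n,
      (if SignedPerm.descents w⁻¹ ⊆ α.descents then 1 else 0) *
        (if SignedPerm.descents w ⊆ β.descents then 1 else 0) := by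
  subst hβ
  rw [symForm_hExt, hα, sum_ite_mul_ite]
  change coeff _ (hBOver R β) = _
  rw [← map_hBOver, ← hB_eq, coeff_map, coeff_levelContent_hB]
  exact Int.cast_natCast _

theorem symForm_sB (α β : PseudoComp) :
    symForm R (toExtended R (sB α)) (toExtended R (sB β)) = (formCoeff α β : R) := by
  rw [toExtended_sB, toExtended_sB, LinearMap.BilinForm.sum_left]
  simp only [LinearMap.BilinForm.sum_right, LinearMap.BilinForm.smul_left,
    LinearMap.BilinForm.smul_right]
  by_cases h : α.size = β.size
  · have := Fintype.ofFinite (SignedPerm β.size)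
    have hform {α' β' : PseudoComp} (hα' : α' ∈ coarsenings α) (hβ' : β' ∈ coarsenings β) :=
      symForm_hExt_hExt R ((mem_coarsenings.1 hα').1.trans h) (mem_coarsenings.1 hβ').1
    rw [formCoeff_of_size_eq h, ← sum_ite_mul_ite]
    simp only [← sum_coarsenings_neg_one_pow_ite_subset, sum_mul_sum]
    rw [sum_comm (s := univ)]
    refine sum_congr rfl fun α' hα' => ?_
    rw [sum_comm (s := univ)]
    refine sum_congr rfl fun β' hβ' => ?_
    rw [hform hα' hβ', mul_sum, mul_sum]
    exact sum_congr rfl fun w _ => by ring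
  · rw [formCoeff, if_neg h, Nat.cast_zero]
    refine sum_eq_zero fun α' hα' => sum_eq_zero fun β' hβ' => ?_
    rw [symForm_hExt_hExt_of_size_ne, mul_zero, mul_zero]
    rwa [(mem_coarsenings.1 hα').1, (mem_coarsenings.1 hβ').1]

theorem symForm_isSymm : (symForm R).IsSymm := by
  have hflip : symForm R = LinearMap.BilinForm.flip (symForm R) := bilinForm_ext_sB fun α β => by
    rw [LinearMap.BilinForm.flip_apply, symForm_sB, symForm_sB, formCoeff_comm]
  exact ⟨fun x y => LinearMap.congr_fun₂ hflip x y⟩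

theorem symForm_nondegenerate : (symForm R).Nondegenerate :=
  nondegenerate_of_apply_eq_repr (hBasis R) (mBasis R) (symForm_hBasis R)

end form

end TypeB

end

theorem mainTheorem10_general :
    (∀ (l : PseudoPart) (α : PseudoComp), α.toPart = l → hB α = hB l.1) ∧
    (∃ b : Module.Basis PseudoPart ℤ SymB,
      ∀ l : PseudoPart, (b l : MvPowerSeries ℕ ℤ) = hB l.1) ∧
    SymB < polyMul ℤ SymF ∧
    Function.Injective (tensorMul ℤ SymF) ∧
    LinearMap.range (tensorMul ℤ SymF) = polyMul ℤ SymF ∧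
    ∀ (K : Type*) [CommRing K] [Algebra ℚ K],
      Function.Injective (scalarExt K SymB) ∧
      Function.Injective (scalarExt K SymF) ∧
      extended K SymB = polyMul K (extended K SymF) ∧
      Function.Injective (tensorMul K (extended K SymF)) ∧
      LinearMap.range (tensorMul K (extended K SymF)) = polyMul K (extended K SymF) ∧
      ∃ h m : Module.Basis PseudoPart K (extended K SymB),
        (∀ l : PseudoPart, (h l : MvPowerSeries ℕ K) =
          MvPowerSeries.map (Int.castRingHom K) (hB l.1)) ∧
        (∀ l : PseudoPart, (m l : MvPowerSeries ℕ K) =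
          MvPowerSeries.map (Int.castRingHom K) (mB l)) ∧
        ∃ B : LinearMap.BilinForm K (extended K SymB),
          (∀ α β, B (toExtended K (sB α)) (toExtended K (sB β)) = (formCoeff α β : K)) ∧
          (∀ B' : LinearMap.BilinForm K (extended K SymB),
            (∀ α β, B' (toExtended K (sB α)) (toExtended K (sB β)) = (formCoeff α β : K)) →
              B' = B) ∧
          B.IsSymm ∧ B.Nondegenerate ∧
          (∀ l : PseudoPart, B (h l) (m l) = 1) ∧
          ∀ l l' : PseudoPart, l ≠ l' → B (h l) (m l') = 0 := by
  refine ⟨?_, ⟨hBasisInt, fun l => ?_⟩, symB_lt_polyMul, ?_, range_tensorMul ℤ SymF, ?_⟩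
  · rintro _ α rfl
    rw [hB_eq, hB_eq, hBOver_toPart]
  · rw [coe_hBasisInt, hB_eq]
  · rw [symF_eq_adjoin]
    exact tensorMul_adjoin_hPos_injective
  intro K _ _
  have : Module.Flat ℤ K := .trans ℤ ℚ K
  refine ⟨scalarExt_injective K symB_le_span_mOver, scalarExt_injective K symF_le_span_mOver,
    extended_symB_eq_polyMul K, ?_, range_tensorMul K _, hBasis K, mBasis K, fun l => ?_,
    fun l => ?_, symForm K, symForm_sB K,
    fun B' hB' => bilinForm_ext_sB fun α β => (hB' α β).trans (symForm_sB K α β).symm,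
    symForm_isSymm K, symForm_nondegenerate K, fun l => ?_, fun l l' h => ?_⟩
  · rw [extended_symF]
    exact tensorMul_adjoin_hPos_injective
  · rw [coe_hBasis, hB_eq, map_hBOver]
  · rw [coe_mBasis, mB_eq, map_mOver]
  · rw [symForm_hBasis, Module.Basis.repr_self, Finsupp.single_eq_same]
  · rw [symForm_hBasis, Module.Basis.repr_self, Finsupp.single_eq_of_ne h]

theorem mainTheorem10 :
    -- `hᴮ_λ` is well defined
    (∀ (l : PseudoPart) (α : PseudoComp), α.toPart = l → hB α = hB l.1) ∧
    -- the `hᴮ_λ` form a free `ℤ`-basis of `Symᴮ`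
    (∃ b : Module.Basis PseudoPart ℤ SymB,
      ∀ l : PseudoPart, (b l : MvPowerSeries ℕ ℤ) = hB l.1) ∧
    -- `Symᴮ ⊊ ℤ[x₀] · Sym ≅ ℤ[x₀] ⊗ Sym`
    SymB < polyMul ℤ SymF ∧
    Function.Injective (tensorMul ℤ SymF) ∧
    LinearMap.range (tensorMul ℤ SymF) = polyMul ℤ SymF ∧
    ∀ (K : Type*) [Field K] [CharZero K],
      -- `Symᴮ_K` and `Sym_K` are the extensions of scalars
      Function.Injective (scalarExt K SymB) ∧
      Function.Injective (scalarExt K SymF) ∧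
      -- `Symᴮ_K = K[x₀] · Sym_K ≅ K[x₀] ⊗ Sym_K`
      extended K SymB = polyMul K (extended K SymF) ∧
      Function.Injective (tensorMul K (extended K SymF)) ∧
      LinearMap.range (tensorMul K (extended K SymF)) = polyMul K (extended K SymF) ∧
      -- dual bases with respect to the nondegenerate symmetric bilinear form
      ∃ h m : Module.Basis PseudoPart K (extended K SymB),
        (∀ l : PseudoPart, (h l : MvPowerSeries ℕ K) =
          MvPowerSeries.map (Int.castRingHom K) (hB l.1)) ∧
        (∀ l : PseudoPart, (m l : MvPowerSeries ℕ K) =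
          MvPowerSeries.map (Int.castRingHom K) (mB l)) ∧
        ∃ B : LinearMap.BilinForm K (extended K SymB),
          IsSymBForm K B ∧ (∀ B', IsSymBForm K B' → B' = B) ∧
          B.IsSymm ∧ B.Nondegenerate ∧
          (∀ l : PseudoPart, B (h l) (m l) = 1) ∧
          ∀ l l' : PseudoPart, l ≠ l' → B (h l) (m l') = 0 := by
  obtain ⟨hwd, hbasis, hlt, hinj, hrange, hfield⟩ := mainTheorem10_general
  exact ⟨hwd, hbasis, hlt, hinj, hrange, fun K _ _ => hfield K⟩
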